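/- Let $d\ge 0$ be an integer, let $V\colon\mathbf{R}^d\to\mathbf{R}$ be smooth and bounded from below, and let $t>0$. For $T>0$ let $\mathbf{P}^{(0)}_T$ denote the law on $\mathcal{C}([0,T],\mathbf{R}^d)$ of the standard $d$-dimensional Brownian bridge from $0$ to $0$ on $[0,T]$, namely the centred Gaussian process with covariance $\mathbf{E}\,\Phi^i_s\Phi^j_u=\delta_{ij}\,(s\wedge u-su/T)$. Set $P_t(x,y)=(2\pi t)^{-d/2}e^{-|x-y|^2/(2t)}$ and define the Feynman–Kac kernel $$P_t^V(x,y)=P_t(x,y)\int\exp\Bigl(-\int_0^tV\Bigl(\Phi_s+\frac{sy+(t-s)x}{t}\Bigr)\,ds\Bigr)\,\mathbf{P}^{(0)}_t(d\Phi)\;,\qquad x,y\in\mathbf{R}^d.$$ On $\mathcal{C}([0,2t],\mathbf{R}^d)$ consider the measures $$\hat{\mathbf{P}}_t=\int_{\mathbf{R}^d}\tau^{(c)}_*\mathbf{P}^{(0)}_{2t}\,dc\;,\quad (\tau^{(c)}\Phi)(s)=\Phi(s)+c\;,\qquad \hat{\mathbf{P}}^V_t(d\Phi)=\exp\Bigl(-\int_0^{2t}V(\Phi_s)\,ds\Bigr)\,\hat{\mathbf{P}}_t(d\Phi)\;,$$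 and let $\pi\Phi=(\Phi_0,\Phi_t)\in\mathbf{R}^d\times\mathbf{R}^d$. Half-densities $f_1\sqrt{\nu_1}$ and $f_2\sqrt{\nu_2}$, with $\nu_1,\nu_2$ positive Radon (here: locally finite Borel) measures, are identified if there is a positive Radon measure $\mu$ with $\nu_1,\nu_2\ll\mu$ and $f_1\sqrt{d\nu_1/d\mu}=f_2\sqrt{d\nu_2/d\mu}$ $\mu$-almost everywhere; $\sqrt{\nu}$ stands for $1\cdot\sqrt{\nu}$. Then $\pi_*\hat{\mathbf{P}}^V_t$ is a Radon measure on $\mathbf{R}^d\times\mathbf{R}^d$ and, as half-densities, $$P_t^V\,\sqrt{dx\,dy}=\sqrt{(4\pi t)^{-d/2}\,\pi_*\hat{\mathbf{P}}^V_t}\;.$$ Moreover $P_t^V\in L^2(\mathbf{R}^d\times\mathbf{R}^d,dx\,dy)$ if and only if $\hat{\mathbf{P}}^V_t$ is finite, so that in this case (and only in this case) both sides are elements of the Hilbert space of square-integrable half-densities. -/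

import Mathlib

open Filter Topology MeasureTheory ProbabilityTheory

/-- Continuous paths `[0, T] → ℝ^d` with the topology of uniform convergence. -/
abbrev PathSpace (d : ℕ) (T : ℝ) : Type := C(Set.Icc (0 : ℝ) T, EuclideanSpace ℝ (Fin d))

instance instMeasurableSpacePathSpace (d : ℕ) (T : ℝ) : MeasurableSpace (PathSpace d T) := borel _

instance instBorelSpacePathSpace (d : ℕ) (T : ℝ) : BorelSpace (PathSpace d T) := ⟨rfl⟩

/-- `μ` is the law on path space of the standard `d`-dimensional Brownian bridge on `[0, T]` (from
`0` to `0`): under `μ` the coordinate process is Gaussian, centred, and has covariance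
`𝔼 Φ_s^i Φ_u^j = δ_{ij} (s ∧ u - s u / T)`. -/
structure IsBrownianBridgeLaw {d : ℕ} {T : ℝ} (μ : Measure (PathSpace d T)) : Prop where
  gaussian : IsGaussianProcess (fun (s : Set.Icc (0 : ℝ) T) (Φ : PathSpace d T) => Φ s) μ
  mean : ∀ s : Set.Icc (0 : ℝ) T, ∫ Φ, Φ s ∂μ = 0
  cov : ∀ (s u : Set.Icc (0 : ℝ) T) (i j : Fin d),
    cov[fun Φ : PathSpace d T => Φ s i, fun Φ : PathSpace d T => Φ u j; μ] =
      if i = j then min (s : ℝ) u - s * u / T else 0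

/-! Existence of the Brownian bridge, by Lévy's midpoint construction. The namespace below serves only
to prove `exists_isBrownianBridgeLaw`; its definitions do not occur in the main statement. -/

namespace BridgeConstruction

def clamp (x : ℝ) : ℝ := max 0 (min 1 x)
def tent (x : ℝ) : ℝ := min x (1 - x)
def hat (j k : ℕ) (x : ℝ) : ℝ := tent (clamp (2 ^ j * x - k))
def kap (x y : ℝ) : ℝ := min x y - x * y

theorem clamp_mem (x : ℝ) : 0 ≤ clamp x ∧ clamp x ≤ 1 := by
  unfold clamp; constructor
  · exact le_max_left _ _
  · exact max_le zero_le_one (min_le_left _ _)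

theorem clamp_of_mem {x : ℝ} (h0 : 0 ≤ x) (h1 : x ≤ 1) : clamp x = x := by
  simp [clamp, h0, h1]

theorem clamp_of_le {x : ℝ} (h : x ≤ 0) : clamp x = 0 := by
  unfold clamp; rw [min_eq_right (by linarith), max_eq_left h]

theorem clamp_of_ge {x : ℝ} (h : 1 ≤ x) : clamp x = 1 := by
  unfold clamp; rw [min_eq_left h]; norm_num

theorem tent_nonneg {x : ℝ} (h0 : 0 ≤ x) (h1 : x ≤ 1) : 0 ≤ tent x :=
  le_min h0 (by linarith)

theorem continuous_hat (j k : ℕ) : Continuous (hat j k) := by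
  unfold hat tent clamp; fun_prop

theorem hat_nonneg (j k : ℕ) (x : ℝ) : 0 ≤ hat j k x :=
  tent_nonneg (clamp_mem _).1 (clamp_mem _).2

theorem hat_le_one (j k : ℕ) (x : ℝ) : hat j k x ≤ 1 :=
  (min_le_left _ _).trans (clamp_mem _).2

theorem tent_clamp_le (w : ℝ) : tent (clamp w) ≤ clamp w - clamp (w - 1) := by
  rcases le_total w 0 with h | h
  · rw [clamp_of_le h, clamp_of_le (by linarith : w - 1 ≤ 0)]; simp [tent]
  rcases le_total w 1 with h' | h'
  · rw [clamp_of_mem h h', clamp_of_le (by linarith : w - 1 ≤ 0)]; simp [tent]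
  · rw [clamp_of_ge h']
    have := (clamp_mem (w - 1)).2
    simp [tent]; linarith

theorem sum_tent_le (w : ℝ) (n : ℕ) :
    ∑ k ∈ Finset.range n, tent (clamp (w - k)) ≤ clamp w - clamp (w - n) := by
  induction n with
  | zero => simp
  | succ n ih =>
    rw [Finset.sum_range_succ]
    have := tent_clamp_le (w - n)
    push_cast
    rw [show w - (n + 1 : ℝ) = w - n - 1 by ring]
    linarith

theorem sum_hat_le (j n : ℕ) (x : ℝ) : ∑ k ∈ Finset.range n, hat j k x ≤ 1 := by
  have := sum_tent_le (2 ^ j * x) n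
  have h1 := clamp_mem (2 ^ j * x)
  have h2 := clamp_mem (2 ^ j * x - n)
  unfold hat; linarith

theorem kap_nonneg {x y : ℝ} (hx : 0 ≤ x) (hx' : x ≤ 1) (hy : 0 ≤ y) (hy' : y ≤ 1) :
    0 ≤ kap x y := by
  unfold kap
  rcases le_total x y with h | h
  · rw [min_eq_left h]; nlinarith
  · rw [min_eq_right h]; nlinarith

theorem kap_le_tent {x y : ℝ} (hx : 0 ≤ x) (hx' : x ≤ 1) (hy : 0 ≤ y) (hy' : y ≤ 1) :
    kap x y ≤ tent x := by
  unfold kap tent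
  rcases le_total x y with h | h
  · rw [min_eq_left h]; apply le_min <;> nlinarith
  · rw [min_eq_right h]; apply le_min <;> nlinarith

theorem kap_split {x y : ℝ} (hx : 0 ≤ x) (hx' : x ≤ 1) (hy : 0 ≤ y) (hy' : y ≤ 1) :
    kap x y = tent x * tent y + (kap (clamp (2 * x)) (clamp (2 * y))
      + kap (clamp (2 * x - 1)) (clamp (2 * y - 1))) / 2 := by
  have key : ∀ a b : ℝ, 0 ≤ a → a ≤ b → b ≤ 1 → kap a b = tent a * tent b +
      (kap (clamp (2 * a)) (clamp (2 * b)) + kap (clamp (2 * a - 1)) (clamp (2 * b - 1))) / 2 := by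
    intro a b ha hab hb
    rcases le_total b (1 / 2) with h | h
    · rw [clamp_of_mem (x := 2 * a) (by linarith) (by linarith),
        clamp_of_mem (x := 2 * b) (by linarith) (by linarith),
        clamp_of_le (x := 2 * a - 1) (by linarith), clamp_of_le (x := 2 * b - 1) (by linarith)]
      unfold kap tent
      rw [min_eq_left hab, min_eq_left (by linarith : 2 * a ≤ 2 * b),
        min_eq_left (by linarith : a ≤ 1 - a), min_eq_left (by linarith : b ≤ 1 - b)]
      simp; ring
    rcases le_total a (1 / 2) with h' | h'
    · rw [clamp_of_mem (x := 2 * a) (by linarith) (by linarith),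
        clamp_of_ge (x := 2 * b) (by linarith),
        clamp_of_le (x := 2 * a - 1) (by linarith),
        clamp_of_mem (x := 2 * b - 1) (by linarith) (by linarith)]
      unfold kap tent
      rw [min_eq_left hab, min_eq_left (by linarith : 2 * a ≤ 1),
        min_eq_left (by linarith : a ≤ 1 - a), min_eq_right (by linarith : 1 - b ≤ b),
        min_eq_left (by linarith : (0:ℝ) ≤ 2 * b - 1)]
      ring
    · rw [clamp_of_ge (x := 2 * a) (by linarith),
        clamp_of_ge (x := 2 * b) (by linarith),
        clamp_of_mem (x := 2 * a - 1) (by linarith) (by linarith),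
        clamp_of_mem (x := 2 * b - 1) (by linarith) (by linarith)]
      unfold kap tent
      rw [min_eq_left hab, min_self,
        min_eq_right (by linarith : 1 - a ≤ a), min_eq_right (by linarith : 1 - b ≤ b),
        min_eq_left (by linarith : 2 * a - 1 ≤ 2 * b - 1)]
      ring
  have comm : ∀ a b : ℝ, kap a b = kap b a := fun a b => by
    unfold kap; rw [min_comm, mul_comm]
  rcases le_total x y with h | h
  · exact key x y hx h hy'
  · rw [comm x y, key y x hy h hx', comm (clamp (2 * y)), comm (clamp (2 * y - 1)), mul_comm]

theorem clamp_two_clamp (w : ℝ) : clamp (2 * clamp w) = clamp (2 * w) := by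
  rcases le_total w 0 with h | h
  · rw [clamp_of_le h, clamp_of_le (x := 2 * w) (by linarith), clamp_of_le (by simp)]
  rcases le_total w 1 with h' | h'
  · rw [clamp_of_mem h h']
  · rw [clamp_of_ge h', clamp_of_ge (x := 2 * w) (by linarith), clamp_of_ge (by norm_num)]

theorem clamp_two_clamp_sub (w : ℝ) : clamp (2 * clamp w - 1) = clamp (2 * w - 1) := by
  rcases le_total w 0 with h | h
  · rw [clamp_of_le h, clamp_of_le (x := 2 * w - 1) (by linarith), clamp_of_le (by simp)]
  rcases le_total w 1 with h' | h'
  · rw [clamp_of_mem h h']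
  · rw [clamp_of_ge h', clamp_of_ge (x := 2 * w - 1) (by linarith), clamp_of_ge (by norm_num)]

theorem sum_range_double (f : ℕ → ℝ) (n : ℕ) :
    ∑ k ∈ Finset.range (2 * n), f k = ∑ k ∈ Finset.range n, (f (2 * k) + f (2 * k + 1)) := by
  induction n with
  | zero => simp
  | succ n ih =>
    rw [show 2 * (n + 1) = 2 * n + 1 + 1 by ring, Finset.sum_range_succ, Finset.sum_range_succ, ih,
      Finset.sum_range_succ]
    ring

theorem kap_iter {x y : ℝ} (hx : 0 ≤ x) (hx' : x ≤ 1) (hy : 0 ≤ y) (hy' : y ≤ 1) (J : ℕ) :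
    kap x y = ∑ j ∈ Finset.range J, (1 / 2 ^ j) * ∑ k ∈ Finset.range (2 ^ j), hat j k x * hat j k y
      + (1 / 2 ^ J) * ∑ k ∈ Finset.range (2 ^ J),
        kap (clamp (2 ^ J * x - k)) (clamp (2 ^ J * y - k)) := by
  induction J with
  | zero => simp [clamp_of_mem, hx, hx', hy, hy']
  | succ J ih =>
    rw [ih, Finset.sum_range_succ, add_assoc]
    congr 1
    have h1 : ∀ k : ℕ, kap (clamp (2 ^ J * x - k)) (clamp (2 ^ J * y - k)) =
        hat J k x * hat J k y + (kap (clamp (2 ^ (J + 1) * x - (2 * k : ℕ)))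
          (clamp (2 ^ (J + 1) * y - (2 * k : ℕ))) + kap (clamp (2 ^ (J + 1) * x - (2 * k + 1 : ℕ)))
          (clamp (2 ^ (J + 1) * y - (2 * k + 1 : ℕ)))) / 2 := by
      intro k
      rw [kap_split (clamp_mem _).1 (clamp_mem _).2 (clamp_mem _).1 (clamp_mem _).2,
        clamp_two_clamp, clamp_two_clamp, clamp_two_clamp_sub, clamp_two_clamp_sub]
      unfold hat
      push_cast
      ring_nf
    simp_rw [h1]
    have e : (2 : ℕ) ^ (J + 1) = 2 * 2 ^ J := pow_succ' 2 J
    rw [Finset.sum_add_distrib, mul_add, e, sum_range_double, ← Finset.sum_div]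
    have e' : (1 / 2 ^ (J + 1) : ℝ) = 1 / 2 ^ J / 2 := by rw [pow_succ]; field_simp
    rw [e']
    ring

theorem tendsto_kap {x y : ℝ} (hx : 0 ≤ x) (hx' : x ≤ 1) (hy : 0 ≤ y) (hy' : y ≤ 1) :
    Tendsto (fun J => ∑ j ∈ Finset.range J,
      (1 / 2 ^ j) * ∑ k ∈ Finset.range (2 ^ j), hat j k x * hat j k y) atTop (𝓝 (kap x y)) := by
  have h0 : Tendsto (fun J : ℕ => (1 / 2 : ℝ) ^ J) atTop (𝓝 0) :=
    tendsto_pow_atTop_nhds_zero_of_lt_one (by norm_num) (by norm_num)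
  have h1 : Tendsto (fun J : ℕ => kap x y - (1 / 2 : ℝ) ^ J) atTop (𝓝 (kap x y)) := by
    simpa using tendsto_const_nhds.sub h0
  refine tendsto_of_tendsto_of_tendsto_of_le_of_le h1 tendsto_const_nhds (fun J => ?_) (fun J => ?_)
  all_goals
    have h := kap_iter hx hx' hy hy' J
    have hs0 : 0 ≤ ∑ k ∈ Finset.range (2 ^ J),
        kap (clamp (2 ^ J * x - k)) (clamp (2 ^ J * y - k)) :=
      Finset.sum_nonneg fun k _ =>
        kap_nonneg (clamp_mem _).1 (clamp_mem _).2 (clamp_mem _).1 (clamp_mem _).2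
    have hs1 : ∑ k ∈ Finset.range (2 ^ J),
        kap (clamp (2 ^ J * x - k)) (clamp (2 ^ J * y - k)) ≤ 1 :=
      (Finset.sum_le_sum fun k _ =>
        kap_le_tent (clamp_mem _).1 (clamp_mem _).2 (clamp_mem _).1 (clamp_mem _).2).trans
        (sum_hat_le J (2 ^ J) x)
    have hp : (0 : ℝ) < 1 / 2 ^ J := by positivity
    simp only [one_div, inv_pow] at *
    nlinarith


theorem map_sum_gaussian {N : Type*} (g : N → ℝ) (S : Finset N) :
    (Measure.infinitePi fun _ : N => gaussianReal 0 1).map (fun ω => ∑ n ∈ S, g n * ω n) =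
      gaussianReal 0 (∑ n ∈ S, g n ^ 2).toNNReal := by
  classical
  have hind : iIndepFun (fun n (ω : N → ℝ) => g n * ω n)
      (Measure.infinitePi fun _ : N => gaussianReal 0 1) :=
    iIndepFun_infinitePi (X := fun n x => g n * x) (fun n => by fun_prop)
  induction S using Finset.induction_on with
  | empty => simp
  | insert n S hn ih =>
    have h1 : (Measure.infinitePi fun _ : N => gaussianReal 0 1).map (fun ω => g n * ω n) =
        gaussianReal 0 (g n ^ 2).toNNReal := by
      have : (fun ω : N → ℝ => g n * ω n) = (fun x => g n * x) ∘ (fun ω => ω n) := rfl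
      rw [this, ← Measure.map_map (by fun_prop) (by fun_prop)]
      have h2 := Measure.infinitePi_map_eval (fun _ : N => gaussianReal 0 1) n
      rw [h2, gaussianReal_map_const_mul]
      congr 1
      · simp
      · ext; simp [sq_nonneg]
    have h3 := hind.indepFun_finsetSum_of_notMem (fun n => by fun_prop) hn
    have h4 : (fun ω : N → ℝ => ∑ n ∈ insert n S, g n * ω n) =
        (∑ j ∈ S, fun ω : N → ℝ => g j * ω j) + (fun ω => g n * ω n) := by
      ext ω; simp [Finset.sum_insert hn, add_comm]
    have h5 : (∑ j ∈ S, fun ω : N → ℝ => g j * ω j) = fun ω => ∑ n ∈ S, g n * ω n := by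
      ext ω; simp
    rw [h4, gaussianReal_add_gaussianReal_of_indepFun h3 (by rw [h5]; exact ih) h1, add_zero,
      Finset.sum_insert hn, ← Real.toNNReal_add (Finset.sum_nonneg fun _ _ => sq_nonneg _)
        (sq_nonneg _), add_comm]

theorem map_eq_gaussian_of_tendsto {Ω : Type*} [MeasurableSpace Ω] {P : Measure Ω}
    [IsProbabilityMeasure P] {Y : ℕ → Ω → ℝ} {Z : Ω → ℝ} {v : ℕ → ℝ} {w : ℝ}
    (hY : ∀ J, Measurable (Y J)) (hv0 : ∀ J, 0 ≤ v J)
    (hlaw : ∀ J, P.map (Y J) = gaussianReal 0 (v J).toNNReal)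
    (hlim : ∀ᵐ ω ∂P, Tendsto (fun J => Y J ω) atTop (𝓝 (Z ω)))
    (hv : Tendsto v atTop (𝓝 w)) : P.map Z = gaussianReal 0 w.toNNReal := by
  have hZ : AEMeasurable Z P := aemeasurable_of_tendsto_metrizable_ae atTop
    (fun J => (hY J).aemeasurable) hlim
  have hw : 0 ≤ w := ge_of_tendsto' hv hv0
  have : IsProbabilityMeasure (P.map Z) := Measure.isProbabilityMeasure_map hZ
  refine Measure.ext_of_charFun ?_
  ext t
  rw [charFun_gaussianReal, charFun_apply_real, integral_map hZ (by fun_prop)]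
  have h1 : Tendsto (fun J => ∫ ω, Complex.exp (t * (Y J ω : ℂ) * Complex.I) ∂P) atTop
      (𝓝 (∫ ω, Complex.exp (t * (Z ω : ℂ) * Complex.I) ∂P)) := by
    refine tendsto_integral_of_dominated_convergence (fun _ => 1) (fun J => ?_)
      (integrable_const _) (fun J => ?_) ?_
    · have := hY J
      exact Measurable.aestronglyMeasurable (by fun_prop)
    · refine Eventually.of_forall fun ω => ?_
      rw [← Complex.ofReal_mul, Complex.norm_exp_ofReal_mul_I]
    · filter_upwards [hlim] with ω h
      have hc : Continuous fun x : ℝ => Complex.exp (t * (x : ℂ) * Complex.I) := by fun_prop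
      exact (hc.tendsto _).comp h
  have h2 : ∀ J, ∫ ω, Complex.exp (t * (Y J ω : ℂ) * Complex.I) ∂P
      = Complex.exp (-((v J * t ^ 2 / 2 : ℝ) : ℂ)) := by
    intro J
    have := charFun_gaussianReal (μ := 0) (v := (v J).toNNReal) t
    rw [← hlaw J, charFun_apply_real, integral_map (hY J).aemeasurable (by fun_prop)] at this
    rw [this]
    congr 1
    simp [hv0 J]
  simp_rw [h2] at h1
  have h3 : Tendsto (fun J => Complex.exp (-((v J * t ^ 2 / 2 : ℝ) : ℂ))) atTop
      (𝓝 (Complex.exp (-((w * t ^ 2 / 2 : ℝ) : ℂ)))) := by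
    have hc : Continuous fun x : ℝ => Complex.exp (-((x * t ^ 2 / 2 : ℝ) : ℂ)) := by fun_prop
    exact (hc.tendsto _).comp hv
  rw [tendsto_nhds_unique h1 h3]
  congr 1
  simp [hw]

theorem ae_summable_of_lintegral {Ω : Type*} [MeasurableSpace Ω] {P : Measure Ω}
    {B : ℕ → Ω → ℝ} {b : ℕ → ℝ} (hB : ∀ j, Measurable (B j)) (hB0 : ∀ j ω, 0 ≤ B j ω)
    (hint : ∀ j, Integrable (B j) P) (hle : ∀ j, ∫ ω, B j ω ∂P ≤ b j) (hb : Summable b) :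
    ∀ᵐ ω ∂P, Summable fun j => B j ω := by
  have h1 : ∫⁻ ω, ∑' j, ENNReal.ofReal (B j ω) ∂P ≠ (⊤ : ENNReal) := by
    rw [lintegral_tsum (fun j => (hB j).ennreal_ofReal.aemeasurable)]
    have : ∀ j, ∫⁻ ω, ENNReal.ofReal (B j ω) ∂P ≤ ENNReal.ofReal (b j) := by
      intro j
      rw [← ofReal_integral_eq_lintegral_ofReal (hint j) (Eventually.of_forall (hB0 j))]
      exact ENNReal.ofReal_le_ofReal (hle j)
    exact ne_top_of_le_ne_top hb.tsum_ofReal_ne_top (ENNReal.tsum_le_tsum this)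
  have h2 := ae_lt_top' (by fun_prop) h1
  filter_upwards [h2] with ω h
  have := ENNReal.summable_toReal h.ne
  refine this.congr fun j => ?_
  rw [ENNReal.toReal_ofReal (hB0 j ω)]


abbrev Idx (d : ℕ) : Type := (Σ _ : ℕ, ℕ) × Fin d

noncomputable abbrev noise (d : ℕ) : Measure (Idx d → ℝ) := Measure.infinitePi fun _ : Idx d => gaussianReal 0 1

noncomputable def bump {d : ℕ} (T : ℝ) (j k : ℕ) (i : Fin d) : PathSpace d T where
  toFun s := (Real.sqrt (T / 2 ^ j) * hat j k (s / T)) • EuclideanSpace.single i (1 : ℝ)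
  continuous_toFun := by
    have := continuous_hat j k
    fun_prop

noncomputable def level {d : ℕ} (T : ℝ) (j : ℕ) (ω : Idx d → ℝ) : PathSpace d T :=
  ∑ k ∈ Finset.range (2 ^ j), ∑ i, ω (⟨j, k⟩, i) • bump T j k i

noncomputable def path {d : ℕ} (T : ℝ) (ω : Idx d → ℝ) : PathSpace d T := ∑' j, level T j ω

theorem measurable_level {d : ℕ} (T : ℝ) (j : ℕ) :
    Measurable (fun ω : Idx d → ℝ => level T j ω) := by
  unfold level
  refine Finset.measurable_sum _ fun k _ => Finset.measurable_sum _ fun i _ => ?_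
  exact (measurable_pi_apply _).smul_const _

theorem abs_le_add (x M : ℝ) (hM : 0 < M) : |x| ≤ M + x ^ 4 / M ^ 3 := by
  rcases le_total |x| M with h | h
  · have : 0 ≤ x ^ 4 / M ^ 3 := by positivity
    linarith
  · have : |x| ≤ x ^ 4 / M ^ 3 := by
      rw [le_div_iff₀ (by positivity), show x ^ 4 = |x| ^ 4 by rw [← abs_pow, abs_of_nonneg (by positivity)]]
      have h3 : M ^ 3 ≤ |x| ^ 3 := by gcongr
      nlinarith [abs_nonneg x]
    linarith

noncomputable def bnd {d : ℕ} (T a : ℝ) (j : ℕ) (ω : Idx d → ℝ) : ℝ :=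
  Real.sqrt (T / 2 ^ j) *
    ∑ i, (a ^ j + ∑ k ∈ Finset.range (2 ^ j), ω (⟨j, k⟩, i) ^ 4 / (a ^ j) ^ 3)

theorem norm_level_le {d : ℕ} (T a : ℝ) (ha : 0 < a) (j : ℕ) (ω : Idx d → ℝ) :
    ‖level T j ω‖ ≤ bnd T a j ω := by
  have hb : 0 ≤ bnd T a j ω := by unfold bnd; positivity
  rw [ContinuousMap.norm_le _ hb]
  intro s
  have e : level T j ω s = ∑ i, ∑ k ∈ Finset.range (2 ^ j),
      ω (⟨j, k⟩, i) • bump T j k i s := by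
    rw [Finset.sum_comm]
    simp [level]
  rw [e]
  refine (norm_sum_le _ _).trans ?_
  unfold bnd
  rw [Finset.mul_sum]
  refine Finset.sum_le_sum fun i _ => (norm_sum_le _ _).trans ?_
  have h1 : ∀ k ∈ Finset.range (2 ^ j), ‖ω (⟨j, k⟩, i) • bump T j k i s‖ ≤
      Real.sqrt (T / 2 ^ j) * (hat j k (s / T) * a ^ j + ω (⟨j, k⟩, i) ^ 4 / (a ^ j) ^ 3) := by
    intro k _
    have e2 : ‖ω (⟨j, k⟩, i) • bump T j k i s‖ =
        |ω (⟨j, k⟩, i)| * (Real.sqrt (T / 2 ^ j) * hat j k (s / T)) := by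
      simp only [bump, ContinuousMap.coe_mk, norm_smul, PiLp.norm_single, norm_one,
        Real.norm_eq_abs, abs_mul, abs_of_nonneg (hat_nonneg _ _ _), mul_one,
        abs_of_nonneg (Real.sqrt_nonneg _)]
    rw [e2, mul_comm, mul_assoc]
    refine mul_le_mul_of_nonneg_left ?_ (Real.sqrt_nonneg _)
    have h2 := abs_le_add (ω (⟨j, k⟩, i)) (a ^ j) (by positivity)
    have h3 : 0 ≤ ω (⟨j, k⟩, i) ^ 4 / (a ^ j) ^ 3 := by positivity
    have h4 := hat_nonneg j k (s / T)
    have h5 := hat_le_one j k (s / T)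
    calc _ ≤ hat j k (s / T) * (a ^ j + ω (⟨j, k⟩, i) ^ 4 / (a ^ j) ^ 3) := by gcongr
      _ ≤ _ := by nlinarith
  refine (Finset.sum_le_sum h1).trans ?_
  rw [← Finset.mul_sum, Finset.sum_add_distrib, ← Finset.sum_mul]
  have h6 := sum_hat_le j (2 ^ j) (s / T)
  have h7 : 0 < a ^ j := by positivity
  gcongr
  nlinarith

theorem ae_summable_level (d : ℕ) {T : ℝ} (hT : 0 < T) :
    ∀ᵐ ω ∂(noise d), Summable fun j => level T j ω := by
  obtain ⟨a, ha1, ha4⟩ : ∃ a : ℝ, 1 < a ∧ a ^ 4 = 2 := by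
    refine ⟨Real.sqrt (Real.sqrt 2), ?_, ?_⟩
    · rw [Real.lt_sqrt (by norm_num), Real.lt_sqrt (by norm_num)]; norm_num
    · rw [show 4 = 2 * 2 by norm_num, pow_mul, Real.sq_sqrt (Real.sqrt_nonneg _),
        Real.sq_sqrt (by norm_num)]
  have ha0 : 0 < a := by linarith
  set C : ℝ := ∫ x, x ^ 4 ∂(gaussianReal 0 1) with hC
  have hint : ∀ n : Idx d, Integrable (fun ω : Idx d → ℝ => ω n ^ 4) (noise d) := by
    intro n
    have h := (memLp_id_gaussianReal (μ := 0) (v := 1) 4).integrable_norm_pow (by norm_num)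
    have h' : Integrable (fun x : ℝ => x ^ 4) (gaussianReal 0 1) := by
      refine h.congr (Eventually.of_forall fun x => ?_)
      simp [← abs_pow, abs_of_nonneg (show (0 : ℝ) ≤ x ^ 4 by positivity)]
    exact (measurePreserving_eval_infinitePi (fun _ : Idx d => gaussianReal 0 1) n).integrable_comp_of_integrable h'
  have hval : ∀ n : Idx d, ∫ ω, ω n ^ 4 ∂(noise d) = C := by
    intro n
    have h := (measurePreserving_eval_infinitePi (fun _ : Idx d => gaussianReal 0 1) n).hasLaw
    exact h.integral_comp (f := fun x : ℝ => x ^ 4) (by fun_prop)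
  have hint2 : ∀ j : ℕ, ∀ i : Fin d, Integrable (fun ω : Idx d → ℝ =>
      ∑ k ∈ Finset.range (2 ^ j), ω (⟨j, k⟩, i) ^ 4 / (a ^ j) ^ 3) (noise d) := fun j i =>
    integrable_finsetSum _ fun k _ => (hint _).div_const _
  have hs : ∀ᵐ ω ∂(noise d), Summable fun j => bnd T a j ω := by
    refine ae_summable_of_lintegral (b := fun j => Real.sqrt T * d * (1 + C) * a⁻¹ ^ j)
      (fun j => ?_) (fun j ω => ?_) (fun j => ?_) (fun j => le_of_eq ?_) ?_
    · unfold bnd; fun_prop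
    · unfold bnd; positivity
    · unfold bnd
      exact (integrable_finsetSum _ fun i _ => (integrable_const _).add (hint2 j i)).const_mul _
    · unfold bnd
      rw [integral_const_mul]
      have hadd : ∀ i : Fin d, Integrable (fun ω : Idx d → ℝ => a ^ j +
          ∑ k ∈ Finset.range (2 ^ j), ω (⟨j, k⟩, i) ^ 4 / (a ^ j) ^ 3) (noise d) :=
        fun i => (integrable_const _).add (hint2 j i)
      rw [integral_finsetSum _ fun i _ => hadd i]
      have : ∀ i : Fin d, ∫ ω : Idx d → ℝ, (a ^ j + ∑ k ∈ Finset.range (2 ^ j),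
          ω (⟨j, k⟩, i) ^ 4 / (a ^ j) ^ 3) ∂(noise d) = a ^ j * (1 + C) := by
        intro i
        rw [integral_add (integrable_const _) (hint2 j i),
          integral_finsetSum _ fun k _ => (hint _).div_const _]
        simp_rw [integral_div, hval]
        have e : ((2 : ℕ) ^ j : ℝ) = (a ^ j) ^ 4 := by
          push_cast; rw [← ha4, ← pow_mul, ← pow_mul, mul_comm]
        have hp : a ^ j ≠ 0 := by positivity
        simp
        push_cast at e
        rw [e]; field_simp
      simp_rw [this]
      have e : Real.sqrt (T / 2 ^ j) = Real.sqrt T / (a ^ j) ^ 2 := by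
        rw [Real.sqrt_div hT.le]
        congr 1
        rw [← ha4, ← pow_mul, mul_comm 4 j, show j * 4 = j * 2 * 2 by ring, pow_mul,
          Real.sqrt_sq (by positivity), pow_mul]
      have hp : a ^ j ≠ 0 := by positivity
      rw [e]
      simp
      field_simp
    · exact (summable_geometric_of_lt_one (by positivity) (inv_lt_one_of_one_lt₀ ha1)).mul_left _
  filter_upwards [hs] with ω h
  exact Summable.of_norm_bounded h fun j => norm_level_le T a ha0 j ω

theorem tendsto_path (d : ℕ) {T : ℝ} (hT : 0 < T) :
    ∀ᵐ ω ∂(noise d),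
      Tendsto (fun J => ∑ j ∈ Finset.range J, level T j ω) atTop (𝓝 (path T ω)) := by
  filter_upwards [ae_summable_level d hT] with ω h
  exact h.hasSum.tendsto_sum_nat

theorem aemeasurable_path (d : ℕ) {T : ℝ} (hT : 0 < T) :
    AEMeasurable (fun ω : Idx d → ℝ => path T ω) (noise d) :=
  aemeasurable_of_tendsto_metrizable_ae atTop
    (fun _ => (Finset.measurable_sum _ fun j _ => measurable_level T j).aemeasurable)
    (tendsto_path d hT)

noncomputable def cv {d : ℕ} {T : ℝ} (p q : Set.Icc (0 : ℝ) T × Fin d) : ℝ :=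
  if p.2 = q.2 then min (p.1 : ℝ) q.1 - p.1 * q.1 / T else 0

theorem level_apply {d : ℕ} (T : ℝ) (j : ℕ) (ω : Idx d → ℝ) (p : Set.Icc (0 : ℝ) T × Fin d) :
    level T j ω p.1 p.2 = ∑ k ∈ Finset.range (2 ^ j), ∑ i,
      (Real.sqrt (T / 2 ^ j) * hat j k (p.1 / T) * if p.2 = i then 1 else 0) * ω (⟨j, k⟩, i) := by
  simp only [level, bump, ContinuousMap.coe_sum, Finset.sum_apply, ContinuousMap.coe_smul,
    Pi.smul_apply, ContinuousMap.coe_mk, WithLp.ofLp_sum, WithLp.ofLp_smul, smul_eq_mul,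
    PiLp.single_apply]
  refine Finset.sum_congr rfl fun k _ => Finset.sum_congr rfl fun i _ => ?_
  ring

theorem map_path {d : ℕ} {T : ℝ} (hT : 0 < T) {ι : Type*} [Fintype ι]
    (p : ι → Set.Icc (0 : ℝ) T × Fin d) (l : ι → ℝ) :
    (noise d).map (fun ω => ∑ a, l a * path T ω (p a).1 (p a).2) =
      gaussianReal 0 (∑ a, ∑ b, l a * l b * cv (p a) (p b)).toNNReal := by
  let h : Idx d → ι → ℝ := fun n a => Real.sqrt (T / 2 ^ n.1.1) *
    hat n.1.1 n.1.2 ((p a).1 / T) * if (p a).2 = n.2 then 1 else 0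
  let g : Idx d → ℝ := fun n => ∑ a, l a * h n a
  let S : ℕ → Finset (Idx d) := fun J =>
    ((Finset.range J).sigma fun j => Finset.range (2 ^ j)) ×ˢ Finset.univ
  have hsum : ∀ (J : ℕ) (f : Idx d → ℝ), ∑ n ∈ S J, f n =
      ∑ j ∈ Finset.range J, ∑ k ∈ Finset.range (2 ^ j), ∑ i, f (⟨j, k⟩, i) := by
    intro J f
    simp only [S]
    rw [Finset.sum_product, Finset.sum_sigma]
  have hY : ∀ (J : ℕ) (ω : Idx d → ℝ), ∑ n ∈ S J, g n * ω n =
      ∑ a, l a * (∑ j ∈ Finset.range J, level T j ω) (p a).1 (p a).2 := by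
    intro J ω
    have h : ∀ a, (∑ j ∈ Finset.range J, level T j ω) (p a).1 (p a).2 =
        ∑ n ∈ S J, h n a * ω n := by
      intro a
      rw [hsum]
      simp only [ContinuousMap.coe_sum, Finset.sum_apply, WithLp.ofLp_sum, level_apply, h]
    simp only [h, g, Finset.sum_mul, Finset.mul_sum]
    rw [Finset.sum_comm]
    exact Finset.sum_congr rfl fun a _ => Finset.sum_congr rfl fun n _ => by ring
  refine map_eq_gaussian_of_tendsto (Y := fun J ω => ∑ n ∈ S J, g n * ω n)
    (v := fun J => ∑ n ∈ S J, g n ^ 2) (fun J => by fun_prop)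
    (fun J => Finset.sum_nonneg fun _ _ => sq_nonneg _) (fun J => map_sum_gaussian g (S J)) ?_ ?_
  · filter_upwards [tendsto_path d hT] with ω h
    simp_rw [hY]
    refine tendsto_finsetSum _ fun a _ => Tendsto.const_mul _ ?_
    have hc : Continuous fun Φ : PathSpace d T => Φ (p a).1 (p a).2 := by fun_prop
    exact (hc.tendsto _).comp h
  · have hv : ∀ J, ∑ n ∈ S J, g n ^ 2 = ∑ a, ∑ b, l a * l b *
        ((if (p a).2 = (p b).2 then T else 0) * ∑ j ∈ Finset.range J, (1 / 2 ^ j) *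
          ∑ k ∈ Finset.range (2 ^ j), hat j k ((p a).1 / T) * hat j k ((p b).1 / T)) := by
      intro J
      have h1 : ∀ n, g n ^ 2 = ∑ a, ∑ b, l a * l b * (h n a * h n b) := by
        intro n
        simp only [g, sq, Finset.sum_mul_sum]
        exact Finset.sum_congr rfl fun a _ => Finset.sum_congr rfl fun b _ => by ring
      simp only [h1]
      rw [Finset.sum_comm]
      refine Finset.sum_congr rfl fun a _ => ?_
      rw [Finset.sum_comm]
      refine Finset.sum_congr rfl fun b _ => ?_
      rw [← Finset.mul_sum, hsum]
      refine congrArg (fun x => l a * l b * x) ?_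
      rw [Finset.mul_sum]
      refine Finset.sum_congr rfl fun j _ => ?_
      rw [← mul_assoc, Finset.mul_sum]
      refine Finset.sum_congr rfl fun k _ => ?_
      simp only [h]
      have h2 : ∀ i, Real.sqrt (T / 2 ^ j) * hat j k ((p a).1 / T) *
          (if (p a).2 = i then 1 else 0) * (Real.sqrt (T / 2 ^ j) * hat j k ((p b).1 / T) *
          (if (p b).2 = i then 1 else 0)) = if (p a).2 = i then (if (p b).2 = i then
            T / 2 ^ j * (hat j k ((p a).1 / T) * hat j k ((p b).1 / T)) else 0) else 0 := by
        intro i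
        have := Real.mul_self_sqrt (show 0 ≤ T / 2 ^ j by positivity)
        split_ifs
        · linear_combination (hat j k ((p a).1 / T) * hat j k ((p b).1 / T)) * this
        all_goals ring
      simp only [h2, Finset.sum_ite_eq, Finset.mem_univ, if_true]
      by_cases hab : (p a).2 = (p b).2
      · rw [if_pos hab, if_pos hab.symm]; ring
      · rw [if_neg hab, if_neg (Ne.symm hab)]; ring
    simp_rw [hv]
    refine tendsto_finsetSum _ fun a _ => tendsto_finsetSum _ fun b _ => Tendsto.const_mul _ ?_
    have hmem : ∀ a, 0 ≤ ((p a).1 : ℝ) / T ∧ ((p a).1 : ℝ) / T ≤ 1 := fun a =>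
      ⟨div_nonneg (p a).1.2.1 hT.le, (div_le_one hT).2 (p a).1.2.2⟩
    have hk := (tendsto_kap (hmem a).1 (hmem a).2 (hmem b).1 (hmem b).2).const_mul
      (if (p a).2 = (p b).2 then T else 0)
    convert hk using 2
    unfold cv kap
    split_ifs
    · rw [min_div_div_right hT.le]; field_simp
    · simp



theorem isBrownianBridgeLaw_map_path (d : ℕ) {T : ℝ} (hT : 0 < T) :
    IsBrownianBridgeLaw ((noise d).map fun ω => path (d := d) T ω) := by
  have hX := aemeasurable_path d hT
  set μ : Measure (PathSpace d T) := (noise d).map fun ω => path (d := d) T ω with hμ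
  have : IsProbabilityMeasure μ := Measure.isProbabilityMeasure_map hX
  have key : ∀ {ι : Type} [Fintype ι] (p : ι → Set.Icc (0 : ℝ) T × Fin d) (l : ι → ℝ),
      μ.map (fun Φ => ∑ a, l a * Φ (p a).1 (p a).2) =
        gaussianReal 0 (∑ a, ∑ b, l a * l b * cv (p a) (p b)).toNNReal := by
    intro ι _ p l
    have hm : Measurable fun Φ : PathSpace d T => ∑ a, l a * Φ (p a).1 (p a).2 :=
      Continuous.measurable (by fun_prop)
    rw [hμ, AEMeasurable.map_map_of_aemeasurable hm.aemeasurable hX]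
    exact map_path hT p l
  have hg : IsGaussianProcess (fun (s : Set.Icc (0 : ℝ) T) (Φ : PathSpace d T) => Φ s) μ := by
    refine ⟨fun I => ⟨isGaussian_of_map_eq_gaussianReal fun L => ?_⟩⟩
    have hm : Measurable fun Φ : PathSpace d T => I.restrict (fun s => Φ s) :=
      Continuous.measurable (by unfold Finset.restrict; fun_prop)
    rw [Measure.map_map L.continuous.measurable hm]
    refine ⟨0, _, Eq.trans ?_ (key (ι := I × Fin d) (fun a => (a.1.1, a.2))
      (fun a => L (Pi.single a.1 (EuclideanSpace.single a.2 1))))⟩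
    congr 1
    ext Φ
    have e : I.restrict (fun s => Φ s) = ∑ a : I × Fin d,
        Φ a.1.1 a.2 • Pi.single a.1 (EuclideanSpace.single a.2 (1 : ℝ)) := by
      ext s i
      rw [Fintype.sum_prod_type]
      simp [Pi.single_apply]
    simp only [Function.comp_apply]
    rw [e, map_sum]
    exact Finset.sum_congr rfl fun a _ => by rw [map_smul, smul_eq_mul, mul_comm]
  have hlaw : ∀ (q r : Set.Icc (0 : ℝ) T × Fin d) (x y : ℝ),
      HasLaw (fun Φ : PathSpace d T => x * Φ q.1 q.2 + y * Φ r.1 r.2) (gaussianReal 0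
        (x * x * cv q q + x * y * cv q r + (y * x * cv r q + y * y * cv r r)).toNNReal) μ := by
    intro q r x y
    refine ⟨(Continuous.measurable (by fun_prop)).aemeasurable, ?_⟩
    simpa [Fin.sum_univ_two] using key ![q, r] ![x, y]
  have hcomm : ∀ q r : Set.Icc (0 : ℝ) T × Fin d, cv q r = cv r q := by
    intro q r
    simp only [cv, eq_comm (a := q.2), min_comm (q.1 : ℝ), mul_comm (q.1 : ℝ)]
  have hone : ∀ q : Set.Icc (0 : ℝ) T × Fin d,
      HasLaw (fun Φ : PathSpace d T => Φ q.1 q.2) (gaussianReal 0 (cv q q).toNNReal) μ := by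
    intro q
    simpa using hlaw q q 1 0
  have hcv : ∀ q r : Set.Icc (0 : ℝ) T × Fin d, 0 ≤ cv q r := by
    intro q r
    have h1 := q.1.2.1
    have h2 := q.1.2.2
    have h3 := r.1.2.1
    have h4 := r.1.2.2
    unfold cv
    split_ifs
    · rw [sub_nonneg, div_le_iff₀ hT]
      rcases le_total (q.1 : ℝ) r.1 with h | h
      · rw [min_eq_left h]; nlinarith
      · rw [min_eq_right h]; nlinarith
    · exact le_rfl
  have hL2 : ∀ q : Set.Icc (0 : ℝ) T × Fin d, MemLp (fun Φ : PathSpace d T => Φ q.1 q.2) 2 μ :=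
    fun q => (hone q).hasGaussianLaw.memLp_two
  refine ⟨hg, fun s => ?_, fun s u i j => ?_⟩
  · ext i
    have h1 := (EuclideanSpace.proj (𝕜 := ℝ) i).integral_comp_comm
      (hg.hasGaussianLaw_eval s).integrable
    have h2 := (hone (s, i)).integral_eq
    rw [integral_id_gaussianReal] at h2
    exact h1.symm.trans h2
  · have h1 := (hlaw (s, i) (u, j) 1 1).variance_eq
    have h2 := variance_fun_add (hL2 (s, i)) (hL2 (u, j))
    simp only [one_mul] at h1
    rw [h2, (hone (s, i)).variance_eq, (hone (u, j)).variance_eq, variance_id_gaussianReal,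
      variance_id_gaussianReal, variance_id_gaussianReal, hcomm (u, j) (s, i),
      Real.coe_toNNReal _ (hcv _ _), Real.coe_toNNReal _ (hcv _ _), Real.coe_toNNReal _
        (add_nonneg (add_nonneg (hcv _ _) (hcv _ _)) (add_nonneg (hcv _ _) (hcv _ _)))] at h1
    change _ = cv (s, i) (u, j)
    linarith

end BridgeConstruction

theorem exists_isBrownianBridgeLaw (d : ℕ) (T : ℝ) :
    ∃ μ : Measure (PathSpace d T), IsBrownianBridgeLaw μ := by
  rcases lt_or_ge 0 T with hT | hT
  · exact ⟨_, BridgeConstruction.isBrownianBridgeLaw_map_path d hT⟩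
  have h0 : ∀ s : Set.Icc (0 : ℝ) T, (s : ℝ) = 0 := fun s => by
    have := s.2.1; have := s.2.2; linarith
  refine ⟨Measure.dirac 0, ⟨fun I => ⟨?_⟩⟩, fun s => ?_, fun s u i j => ?_⟩
  · have hm : Measurable fun Φ : PathSpace d T => I.restrict (fun s => Φ s) :=
      Continuous.measurable (by unfold Finset.restrict; fun_prop)
    rw [Measure.map_dirac' hm]
    infer_instance
  · simp
  · simp [covariance, h0]

/-- The law of the Brownian bridge on `[0, T]` in `ℝ^d`, as a measure on continuous paths: the
measure characterised by `IsBrownianBridgeLaw`. -/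
noncomputable def brownianBridge (d : ℕ) (T : ℝ) : Measure (PathSpace d T) :=
  (exists_isBrownianBridgeLaw d T).choose

theorem isBrownianBridgeLaw_brownianBridge (d : ℕ) (T : ℝ) :
    IsBrownianBridgeLaw (brownianBridge d T) :=
  (exists_isBrownianBridgeLaw d T).choose_spec

/-- The heat kernel of `½ Δ` on `ℝ^d`, i.e. the transition density of standard Brownian motion. -/
noncomputable def heatKernel {d : ℕ} (t : ℝ) (x y : EuclideanSpace ℝ (Fin d)) : ℝ :=
  (2 * Real.pi * t) ^ (-(d : ℝ) / 2) * Real.exp (-‖x - y‖ ^ 2 / (2 * t))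

/-- Lebesgue measure on `[0, T]`. -/
noncomputable def timeMeasure (T : ℝ) : Measure (Set.Icc (0 : ℝ) T) :=
  (volume : Measure ℝ).comap Subtype.val

/-- The Feynman–Kac kernel
`P_t^V(x, y) = P_t(x, y) 𝔼 exp (-∫₀ᵗ V (Φ_s + (s y + (t - s) x) / t) ds)`, where `Φ` is a Brownian
bridge on `[0, t]`. -/
noncomputable def feynmanKacKernel {d : ℕ} (V : EuclideanSpace ℝ (Fin d) → ℝ) (t : ℝ)
    (x y : EuclideanSpace ℝ (Fin d)) : ℝ :=
  heatKernel t x y * ∫ Φ : PathSpace d t, Real.exp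
    (-∫ s, V (Φ s + t⁻¹ • ((s : ℝ) • y + (t - s) • x)) ∂(timeMeasure t)) ∂(brownianBridge d t)

/-- The measure `P̂_t = ∫ τ^{(c)}_* P⁽⁰⁾_{2t} dc` on paths on `[0, 2t]`, i.e. the image of
`dc ⊗ P⁽⁰⁾_{2t}` under `(c, Φ) ↦ Φ + c`, where `P⁽⁰⁾_{2t}` is the law of the Brownian bridge. -/
noncomputable def shiftedBridge (d : ℕ) (t : ℝ) : Measure (PathSpace d (2 * t)) :=
  ((volume : Measure (EuclideanSpace ℝ (Fin d))).prod (brownianBridge d (2 * t))).map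
    fun p => p.2 + ContinuousMap.const _ p.1

/-- The weighted measure `P̂_t^V(dΦ) = exp (-∫₀²ᵗ V(Φ_s) ds) P̂_t(dΦ)`. -/
noncomputable def weightedBridge {d : ℕ} (V : EuclideanSpace ℝ (Fin d) → ℝ) (t : ℝ) :
    Measure (PathSpace d (2 * t)) :=
  (shiftedBridge d t).withDensity fun Φ =>
    ENNReal.ofReal (Real.exp (-∫ s, V (Φ s) ∂(timeMeasure (2 * t))))

/-- The map `Φ ↦ (Φ_0, Φ_t)` on paths on `[0, 2t]`. -/
def endpointMap {d : ℕ} {t : ℝ} (ht : 0 < t) (Φ : PathSpace d (2 * t)) :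
    EuclideanSpace ℝ (Fin d) × EuclideanSpace ℝ (Fin d) :=
  (Φ ⟨0, le_rfl, by linarith⟩, Φ ⟨t, ht.le, by linarith⟩)

/-- The half-densities `f₁ √ν₁` and `f₂ √ν₂` on `X`, where `ν₁` and `ν₂` are positive Radon measures
(for a Borel measure on a Polish space this means locally finite), are equal: for some Radon measure
`μ` dominating `ν₁` and `ν₂` one has `f₁ √(dν₁/dμ) = f₂ √(dν₂/dμ)` almost everywhere for `μ`. -/
def HalfDensityEq {X : Type*} [TopologicalSpace X] [MeasurableSpace X]
    (f₁ : X → ℝ) (ν₁ : Measure X) (f₂ : X → ℝ) (ν₂ : Measure X) : Prop :=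
  IsLocallyFiniteMeasure ν₁ ∧ IsLocallyFiniteMeasure ν₂ ∧
    ∃ μ : Measure X, IsLocallyFiniteMeasure μ ∧ ν₁ ≪ μ ∧ ν₂ ≪ μ ∧
      (fun x => f₁ x * √(ν₁.rnDeriv μ x).toReal) =ᵐ[μ] fun x => f₂ x * √(ν₂.rnDeriv μ x).toReal

/-!
The half-density identity says that the law of `(Φ_0, Φ_t)` under the weighted bridge measure,
normalised by `(4πt)^{-d/2}`, has density `(P_t^V)²` with respect to Lebesgue measure. This in turn
expresses that a loop of duration `2t`, seen from its values `x = Φ_0` and `y = Φ_t`, consists of two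
independent Brownian bridges of duration `t` between `x` and `y`, the second one traversed backwards;
each of them contributes one factor `𝔼 exp (-∫ V)` of `P_t^V(x, y)`.

To see this, a bridge `Φ` on `[0, 2t]` is split into `Φ_s - (s / t) Φ_t`, `Φ_{2t - s} - (s / t) Φ_t`
(`0 ≤ s ≤ t`) and `Φ_t`. The three pieces are jointly Gaussian and uncorrelated, hence independent
(`iIndepFun_bridgePiece`). The first two have the covariance of a bridge on `[0, t]`, hence its law
(`IsBrownianBridgeLaw.unique`), because a Gaussian law on path space is determined by its mean and
covariance: countably many coordinates separate paths, and an injective continuous map between Polish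
spaces is a measurable embedding. The third is Gaussian with variance `t / 2` per coordinate. Since
`exp (-∫₀²ᵗ V)` factorises over the two halves (`exp_neg_integral_add_const`), Fubini gives the
endpoint law (`lintegral_map_endpointMap`), and the Gaussian density at `y - x` times
`(4πt)^{-d/2}` is exactly the square of the heat kernel (`midDensity_mul`).

As `V` is bounded below, `P_t^V` is bounded, so the endpoint law is locally finite; and comparing total
masses in the density identity gives the equivalence of square integrability with finiteness.
-/

/-! ### Gaussian laws on path space -/

/-- Two finite families of jointly Gaussian real variables with the same means and covariances have
the same law. -/
theorem ProbabilityTheory.HasGaussianLaw.map_eq_of_covariance_eq {ι Ω Ω' : Type*} [Fintype ι] {mΩ : MeasurableSpace Ω}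
    {mΩ' : MeasurableSpace Ω'} {P : Measure Ω} {Q : Measure Ω'} {X : ι → Ω → ℝ} {Y : ι → Ω' → ℝ}
    (hX : HasGaussianLaw (fun ω i => X i ω) P) (hY : HasGaussianLaw (fun ω i => Y i ω) Q)
    (hmean : ∀ i, ∫ ω, X i ω ∂P = ∫ ω, Y i ω ∂Q)
    (hcov : ∀ i j, cov[X i, X j; P] = cov[Y i, Y j; Q]) :
    P.map (fun ω i => X i ω) = Q.map (fun ω i => Y i ω) := by
  have := hX.isProbabilityMeasure
  have := hY.isProbabilityMeasure
  have key : P.map (fun ω => WithLp.toLp 2 (X · ω)) = Q.map (fun ω => WithLp.toLp 2 (Y · ω)) := by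
    have hX' := hX.toLp_pi 2
    have hY' := hY.toLp_pi 2
    have := hX'.isGaussian_map
    have := hY'.isGaussian_map
    refine IsGaussian.ext ?_ ?_
    · simp only [id]
      rw [integral_map hX'.aemeasurable (by fun_prop), integral_map hY'.aemeasurable (by fun_prop)]
      ext i
      have h1 := (EuclideanSpace.proj (𝕜 := ℝ) i).integral_comp_comm hX'.integrable
      have h2 := (EuclideanSpace.proj (𝕜 := ℝ) i).integral_comp_comm hY'.integrable
      exact h1.symm.trans ((hmean i).trans h2)
    · ext x y
      rw [covarianceBilin_apply_pi fun i => (hX.eval i).memLp_two,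
        covarianceBilin_apply_pi fun i => (hY.eval i).memLp_two]
      simp_rw [hcov]
  have h := congrArg (Measure.map WithLp.ofLp) key
  rwa [AEMeasurable.map_map_of_aemeasurable (by fun_prop) (hX.toLp_pi 2).aemeasurable,
    AEMeasurable.map_map_of_aemeasurable (by fun_prop) (hY.toLp_pi 2).aemeasurable] at h

theorem ProbabilityTheory.IsGaussianProcess.coordinates {T Ω : Type*} {d : ℕ} {mΩ : MeasurableSpace Ω} {P : Measure Ω}
    {X : T → Ω → EuclideanSpace ℝ (Fin d)} (hX : IsGaussianProcess X P) :
    IsGaussianProcess (fun (p : T × Fin d) ω => X p.1 ω p.2) P :=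
  hX.of_isGaussianProcess fun p =>
    ⟨{p.1}, (EuclideanSpace.proj p.2).comp (ContinuousLinearMap.proj ⟨p.1, by simp⟩), fun _ => rfl⟩

/-- The coordinates of a path at countably many dense times. -/
noncomputable def denseCoordinates (d : ℕ) (T : ℝ) [Nonempty (Set.Icc (0 : ℝ) T)]
    (Φ : PathSpace d T) (p : ℕ × Fin d) : ℝ :=
  Φ (TopologicalSpace.denseSeq (Set.Icc (0 : ℝ) T) p.1) p.2

/-- Countably many coordinates generate the Borel σ-algebra of path space: an injective continuous
map from a Polish space is a measurable embedding. -/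
theorem measurableEmbedding_denseCoordinates (d : ℕ) (T : ℝ) [Nonempty (Set.Icc (0 : ℝ) T)] :
    MeasurableEmbedding (denseCoordinates d T) := by
  refine Continuous.measurableEmbedding ?_ ?_
  · unfold denseCoordinates
    fun_prop
  · intro Φ Ψ h
    have h1 : (Φ : Set.Icc (0 : ℝ) T → EuclideanSpace ℝ (Fin d)) = Ψ := by
      refine Continuous.ext_on (TopologicalSpace.denseRange_denseSeq (Set.Icc (0 : ℝ) T))
        Φ.continuous Ψ.continuous ?_
      rintro _ ⟨n, rfl⟩
      ext i
      exact congrFun h (n, i)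
    exact DFunLike.coe_injective h1

/-- The law of a Brownian bridge is determined by its mean and covariance. -/
theorem IsBrownianBridgeLaw.unique {d : ℕ} {T : ℝ} [Nonempty (Set.Icc (0 : ℝ) T)]
    {μ ν : Measure (PathSpace d T)} (hμ : IsBrownianBridgeLaw μ) (hν : IsBrownianBridgeLaw ν) :
    μ = ν := by
  have := hμ.gaussian.isProbabilityMeasure
  have := hν.gaussian.isProbabilityMeasure
  have hemb := measurableEmbedding_denseCoordinates d T
  refine hemb.map_injective ?_
  have hX : ∀ {ρ : Measure (PathSpace d T)}, IsBrownianBridgeLaw ρ →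
      IsGaussianProcess (fun p Φ => denseCoordinates d T Φ p) ρ := fun hρ =>
    hρ.gaussian.coordinates.comp_right fun p : ℕ × Fin d =>
      (TopologicalSpace.denseSeq (Set.Icc (0 : ℝ) T) p.1, p.2)
  have hm : ∀ {ρ : Measure (PathSpace d T)}, IsBrownianBridgeLaw ρ → ∀ p,
      ∫ Φ, denseCoordinates d T Φ p ∂ρ = 0 := by
    intro ρ hρ p
    have h := (EuclideanSpace.proj (𝕜 := ℝ) p.2).integral_comp_comm (hρ.gaussian.hasGaussianLaw_eval
      (TopologicalSpace.denseSeq (Set.Icc (0 : ℝ) T) p.1)).integrable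
    rw [hρ.mean, map_zero] at h
    exact h
  have hproj : ∀ {ρ : Measure (PathSpace d T)},
      IsProjectiveLimit (ρ.map (denseCoordinates d T))
        (fun I => ρ.map fun Φ => I.restrict (denseCoordinates d T Φ)) := fun {ρ} =>
    isProjectiveLimit_map (X := fun p Φ => denseCoordinates d T Φ p) hemb.measurable.aemeasurable
  have : ∀ I : Finset (ℕ × Fin d),
      IsFiniteMeasure (μ.map fun Φ => I.restrict (denseCoordinates d T Φ)) := fun I =>
    inferInstance
  refine IsProjectiveLimit.unique hproj (fun I => (hproj I).trans ?_)
  refine HasGaussianLaw.map_eq_of_covariance_eq ((hX hν).hasGaussianLaw I)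
    ((hX hμ).hasGaussianLaw I) (fun p => ?_) (fun p q => ?_)
  · exact (hm hν p).trans (hm hμ p).symm
  · exact (hν.cov _ _ _ _).trans (hμ.cov _ _ _ _).symm

/-- Random paths whose coordinates are jointly Gaussian and uncorrelated are independent. -/
theorem iIndepFun_pathSpace_of_covariance_eq_zero {Ω κ : Type*} [Finite κ] {mΩ : MeasurableSpace Ω}
    {P : Measure Ω} {d : ℕ} {T : ℝ} [Nonempty (Set.Icc (0 : ℝ) T)] {X : κ → Ω → PathSpace d T}
    (hX : ∀ k, Measurable (X k))
    (hG : IsGaussianProcess (fun (p : κ × Set.Icc (0 : ℝ) T) ω => X p.1 ω p.2) P)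
    (hcov : ∀ k l, k ≠ l → ∀ s u i j,
      cov[fun ω => X k ω s i, fun ω => X l ω u j; P] = 0) :
    iIndepFun X P := by
  have hemb := measurableEmbedding_denseCoordinates d T
  obtain ⟨g, hg, hg'⟩ := hemb.exists_measurable_extend measurable_id fun _ => ⟨(0 : PathSpace d T)⟩
  have h : iIndepFun (fun k ω (p : ℕ × Fin d) => denseCoordinates d T (X k ω) p) P := by
    refine IsGaussianProcess.iIndepFun_of_covariance_eq_zero (S := fun _ : κ => ℕ × Fin d)
      (X := fun k p ω => denseCoordinates d T (X k ω) p) ?_ (fun k p => ?_) ?_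
    · exact hG.coordinates.comp_right fun p : (_ : κ) × (ℕ × Fin d) =>
        ((p.1, TopologicalSpace.denseSeq (Set.Icc (0 : ℝ) T) p.2.1), p.2.2)
    · exact ((measurable_pi_apply p).comp (hemb.measurable.comp (hX k))).aemeasurable
    · exact fun k l hkl p q => hcov k l hkl _ _ _ _
  have h2 := h.comp (fun _ => g) fun _ => hg
  have e : (fun k => g ∘ fun ω => denseCoordinates d T (X k ω)) = X := by
    ext k ω : 2
    exact congrFun hg' (X k ω)
  exact e ▸ h2

/-! ### Splitting the bridge at its midpoint -/

/-- The embedding `s ↦ s` of the first half of `[0, 2t]`. -/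
def firstHalf (t : ℝ) (s : Set.Icc (0 : ℝ) t) : Set.Icc (0 : ℝ) (2 * t) :=
  ⟨s, s.2.1, by linarith [s.2.1, s.2.2]⟩

/-- The time-reversed embedding `s ↦ 2t - s` of the second half of `[0, 2t]`. -/
def secondHalf (t : ℝ) (s : Set.Icc (0 : ℝ) t) : Set.Icc (0 : ℝ) (2 * t) :=
  ⟨2 * t - s, by linarith [s.2.1, s.2.2], by linarith [s.2.1]⟩

/-- The midpoint `t` of `[0, 2t]`. -/
def midTime {t : ℝ} (ht : 0 < t) : Set.Icc (0 : ℝ) (2 * t) := ⟨t, ht.le, by linarith⟩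

/-- The times at which the pieces of a path are read off: the two halves, the second one run
backwards, and the midpoint. -/
def pieceTime {t : ℝ} (ht : 0 < t) : Fin 3 → C(Set.Icc (0 : ℝ) t, Set.Icc (0 : ℝ) (2 * t)) :=
  ![⟨firstHalf t, by unfold firstHalf; fun_prop⟩, ⟨secondHalf t, by unfold secondHalf; fun_prop⟩,
    ContinuousMap.const _ (midTime ht)]

/-- The coefficient of the midpoint value that is subtracted in `bridgePiece`. -/
noncomputable def pieceCoeff (t : ℝ) : Fin 3 → C(Set.Icc (0 : ℝ) t, ℝ) :=
  ![⟨fun s => s / t, by fun_prop⟩, ⟨fun s => s / t, by fun_prop⟩, 0]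

/-- The three pieces of a path `Φ` on `[0, 2t]`, as paths on `[0, t]`: `Φ_s - (s / t) Φ_t`,
`Φ_{2t - s} - (s / t) Φ_t`, and the constant path `Φ_t`. -/
noncomputable def bridgePiece {d : ℕ} {t : ℝ} (ht : 0 < t) (k : Fin 3) (Φ : PathSpace d (2 * t)) :
    PathSpace d t :=
  Φ.comp (pieceTime ht k) - pieceCoeff t k • ContinuousMap.const _ (Φ (midTime ht))

theorem bridgePiece_apply {d : ℕ} {t : ℝ} (ht : 0 < t) (k : Fin 3) (Φ : PathSpace d (2 * t))
    (s : Set.Icc (0 : ℝ) t) :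
    bridgePiece ht k Φ s = Φ (pieceTime ht k s) - pieceCoeff t k s • Φ (midTime ht) := rfl

theorem continuous_bridgePiece {d : ℕ} {t : ℝ} (ht : 0 < t) (k : Fin 3) :
    Continuous (bridgePiece (d := d) ht k) := by
  refine ContinuousMap.continuous_of_continuous_uncurry _ ?_
  simp only [Function.uncurry_def, bridgePiece_apply]
  fun_prop

/-- Covariance function of a one-dimensional Brownian bridge on `[0, T]`. -/
noncomputable def bridgeCov (T s u : ℝ) : ℝ := min s u - s * u / T

theorem isGaussianProcess_bridgePiece {d : ℕ} {t : ℝ} (ht : 0 < t)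
    {μ : Measure (PathSpace d (2 * t))} (hμ : IsBrownianBridgeLaw μ) :
    IsGaussianProcess (fun (p : Fin 3 × Set.Icc (0 : ℝ) t) Φ => bridgePiece ht p.1 Φ p.2) μ := by
  classical
  refine hμ.gaussian.of_isGaussianProcess fun p => ⟨{pieceTime ht p.1 p.2, midTime ht},
    .proj ⟨pieceTime ht p.1 p.2, by simp⟩ -
      pieceCoeff t p.1 p.2 • .proj ⟨midTime ht, by simp⟩, fun _ => rfl⟩

theorem integral_bridgePiece {d : ℕ} {t : ℝ} (ht : 0 < t)
    {μ : Measure (PathSpace d (2 * t))} (hμ : IsBrownianBridgeLaw μ) (k : Fin 3)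
    (s : Set.Icc (0 : ℝ) t) : ∫ Φ, bridgePiece ht k Φ s ∂μ = 0 := by
  have hint := fun s => (hμ.gaussian.hasGaussianLaw_eval s).integrable
  simp_rw [bridgePiece_apply]
  rw [integral_sub (hint _) ((hint _).fun_smul _), integral_smul, hμ.mean, hμ.mean]
  simp

theorem cov_bridgePiece {d : ℕ} {t : ℝ} (ht : 0 < t)
    {μ : Measure (PathSpace d (2 * t))} (hμ : IsBrownianBridgeLaw μ) (k l : Fin 3)
    (s u : Set.Icc (0 : ℝ) t) (i j : Fin d) :
    cov[fun Φ => bridgePiece ht k Φ s i, fun Φ => bridgePiece ht l Φ u j; μ] =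
      if i = j then bridgeCov (2 * t) (pieceTime ht k s) (pieceTime ht l u)
        - pieceCoeff t l u * bridgeCov (2 * t) (pieceTime ht k s) t
        - pieceCoeff t k s * (bridgeCov (2 * t) t (pieceTime ht l u)
        - pieceCoeff t l u * bridgeCov (2 * t) t t) else 0 := by
  have := hμ.gaussian.isProbabilityMeasure
  have hL : ∀ (a : Set.Icc (0 : ℝ) (2 * t)) (i : Fin d),
      MemLp (fun Φ : PathSpace d (2 * t) => Φ a i) 2 μ := fun a i =>
    (hμ.gaussian.coordinates.hasGaussianLaw_eval (a, i)).memLp_two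
  have hs : ∀ k (Φ : PathSpace d (2 * t)) s i, bridgePiece ht k Φ s i =
      Φ (pieceTime ht k s) i - pieceCoeff t k s * Φ (midTime ht) i := fun _ _ _ _ => rfl
  have hL' : ∀ k s i, MemLp (fun Φ : PathSpace d (2 * t) =>
      Φ (pieceTime ht k s) i - pieceCoeff t k s * Φ (midTime ht) i) 2 μ := fun k s i =>
    (hL _ _).sub ((hL _ _).const_mul _)
  simp_rw [hs]
  rw [covariance_fun_sub_left (hL _ _) ((hL _ _).const_mul _)
      (hL' l u j),
    covariance_fun_sub_right (hL _ _) (hL _ _) ((hL _ _).const_mul _),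
    covariance_const_mul_left, covariance_const_mul_right,
    covariance_fun_sub_right (hL _ _) (hL _ _) ((hL _ _).const_mul _), covariance_const_mul_right]
  simp only [hμ.cov]
  unfold bridgeCov midTime
  split_ifs <;> simp

/-- The halves of a bridge on `[0, 2t]`, each with the linear interpolation towards the midpoint
value removed, are bridges on `[0, t]`. -/
theorem isBrownianBridgeLaw_map_bridgePiece {d : ℕ} {t : ℝ} (ht : 0 < t)
    {μ : Measure (PathSpace d (2 * t))} (hμ : IsBrownianBridgeLaw μ) {k : Fin 3} (hk : k ≠ 2) :
    IsBrownianBridgeLaw (μ.map (bridgePiece ht k)) := by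
  have hm : AEMeasurable (bridgePiece (d := d) ht k) μ :=
    (continuous_bridgePiece ht k).measurable.aemeasurable
  have hev : ∀ s : Set.Icc (0 : ℝ) t, Continuous fun Φ : PathSpace d t => Φ s := fun s => by
    fun_prop
  refine ⟨⟨fun I => ⟨?_⟩⟩, fun s => ?_, fun s u i j => ?_⟩
  · have h : Measurable fun Φ : PathSpace d t => I.restrict (fun s => Φ s) :=
      Continuous.measurable (by unfold Finset.restrict; fun_prop)
    rw [AEMeasurable.map_map_of_aemeasurable h.aemeasurable hm]
    exact (((isGaussianProcess_bridgePiece ht hμ).comp_right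
      fun s => (k, s)).hasGaussianLaw I).isGaussian_map
  · rw [integral_map hm (hev s).aestronglyMeasurable]
    exact integral_bridgePiece ht hμ k s
  · have hc : ∀ (s : Set.Icc (0 : ℝ) t) (i : Fin d), Continuous fun Φ : PathSpace d t => Φ s i :=
      fun s i => by fun_prop
    rw [covariance_map_fun (hc s i).aestronglyMeasurable (hc u j).aestronglyMeasurable hm,
      cov_bridgePiece ht hμ]
    have hs1 := s.2.1
    have hs2 := s.2.2
    have hu1 := u.2.1
    have hu2 := u.2.2
    congr 1
    fin_cases k
    · simp [pieceTime, pieceCoeff, bridgeCov, firstHalf, hs2, hu2]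
      field_simp
      ring
    · have e : min (2 * t - (s : ℝ)) (2 * t - u) = 2 * t - s - u + min (s : ℝ) u := by
        rcases le_total (s : ℝ) u with h | h
        · rw [min_eq_left h, min_eq_right (by linarith)]; ring
        · rw [min_eq_right h, min_eq_left (by linarith)]; ring
      simp [pieceTime, pieceCoeff, bridgeCov, secondHalf, e,
        min_eq_right (show t ≤ 2 * t - (s : ℝ) by linarith),
        min_eq_left (show t ≤ 2 * t - (u : ℝ) by linarith)]
      field_simp
      ring
    · exact absurd rfl hk

/-- The two halves and the midpoint value are jointly Gaussian and uncorrelated, hence independent. -/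
theorem iIndepFun_bridgePiece {d : ℕ} {t : ℝ} (ht : 0 < t)
    {μ : Measure (PathSpace d (2 * t))} (hμ : IsBrownianBridgeLaw μ) :
    iIndepFun (bridgePiece (d := d) ht) μ := by
  have : Nonempty (Set.Icc (0 : ℝ) t) := ⟨⟨0, le_rfl, ht.le⟩⟩
  refine iIndepFun_pathSpace_of_covariance_eq_zero
    (fun k => (continuous_bridgePiece ht k).measurable) (isGaussianProcess_bridgePiece ht hμ) ?_
  intro k l hkl s u i j
  rw [cov_bridgePiece ht hμ]
  have hs1 := s.2.1
  have hs2 := s.2.2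
  have hu1 := u.2.1
  have hu2 := u.2.2
  rw [ite_eq_right_iff]
  intro _
  have h1 := min_eq_left (show (s : ℝ) ≤ 2 * t - u by linarith)
  have h2 := min_eq_right (show (u : ℝ) ≤ 2 * t - s by linarith)
  have h3 := min_eq_right (show t ≤ 2 * t - (s : ℝ) by linarith)
  have h4 := min_eq_left (show t ≤ 2 * t - (u : ℝ) by linarith)
  fin_cases k <;> fin_cases l <;> first | exact absurd rfl hkl | skip
  all_goals
    simp [pieceTime, pieceCoeff, bridgeCov, firstHalf, secondHalf, midTime, h1, h2, h3, h4,
      hs2, hu2]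
    try field_simp
    try ring

/-! ### The law of the midpoint -/

/-- The centred Gaussian density with covariance `(t / 2) • 1`, the density of `Φ_t` for a bridge
`Φ` on `[0, 2t]`. -/
noncomputable def midDensity {d : ℕ} (t : ℝ) (z : EuclideanSpace ℝ (Fin d)) : ℝ :=
  (Real.pi * t) ^ (-(d : ℝ) / 2) * Real.exp (-‖z‖ ^ 2 / t)

theorem continuous_midDensity {d : ℕ} (t : ℝ) : Continuous (midDensity (d := d) t) := by
  unfold midDensity
  fun_prop

theorem midDensity_nonneg {d : ℕ} {t : ℝ} (ht : 0 < t) (z : EuclideanSpace ℝ (Fin d)) :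
    0 ≤ midDensity t z := by
  unfold midDensity
  positivity

theorem integrable_midDensity {d : ℕ} {t : ℝ} (ht : 0 < t) :
    Integrable (midDensity (d := d) t) := by
  have h := (GaussianFourier.integrable_cexp_neg_mul_sq_norm_add
    (V := EuclideanSpace ℝ (Fin d)) (b := ((1 / t : ℝ) : ℂ)) (by simpa using ht) 0 0).norm
  unfold midDensity
  refine (h.const_mul ((Real.pi * t) ^ (-(d : ℝ) / 2))).congr (Eventually.of_forall fun z => ?_)
  simp only [Complex.norm_exp]
  congr 2
  have : (-((1 / t : ℝ) : ℂ) * (‖z‖ : ℂ) ^ 2 + 0 * inner ℝ (0 : EuclideanSpace ℝ (Fin d)) z) =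
    ((-‖z‖ ^ 2 / t : ℝ) : ℂ) := by push_cast; ring
  rw [this, Complex.ofReal_re]

/-- The characteristic function identifies `midDensity` as the density of a probability law, with no
separate computation of its total mass. -/
theorem charFun_midDensity {d : ℕ} {t : ℝ} (ht : 0 < t) (w : EuclideanSpace ℝ (Fin d)) :
    charFun (volume.withDensity fun z => ENNReal.ofReal (midDensity t z)) w =
      Complex.exp (-((t * ‖w‖ ^ 2 / 4 : ℝ) : ℂ)) := by
  have h := GaussianFourier.integral_cexp_neg_mul_sq_norm_add
    (V := EuclideanSpace ℝ (Fin d)) (b := ((1 / t : ℝ) : ℂ)) (by simpa using ht) Complex.I w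
  rw [charFun_apply, integral_withDensity_eq_integral_toReal_smul
    (continuous_midDensity t).measurable.ennreal_ofReal (by simp)]
  have e : ∀ z : EuclideanSpace ℝ (Fin d), (ENNReal.ofReal (midDensity t z)).toReal •
      Complex.exp ((inner ℝ z w : ℝ) * Complex.I) = (((Real.pi * t) ^ (-(d : ℝ) / 2) : ℝ) : ℂ) *
      Complex.exp (-((1 / t : ℝ) : ℂ) * (‖z‖ : ℂ) ^ 2 + Complex.I * (inner ℝ w z : ℝ)) := by
    intro z
    rw [ENNReal.toReal_ofReal (midDensity_nonneg ht z), Complex.real_smul, Complex.exp_add,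
      midDensity, real_inner_comm]
    push_cast
    rw [mul_assoc]
    congr 3 <;> ring_nf
  simp_rw [e]
  rw [integral_const_mul, h, ← mul_assoc]
  have h1 : (((Real.pi * t) ^ (-(d : ℝ) / 2) : ℝ) : ℂ) * ((Real.pi : ℂ) / ((1 / t : ℝ) : ℂ)) ^
      ((Module.finrank ℝ (EuclideanSpace ℝ (Fin d)) : ℂ) / 2) = 1 := by
    have : ((Real.pi : ℂ) / ((1 / t : ℝ) : ℂ)) ^
      ((Module.finrank ℝ (EuclideanSpace ℝ (Fin d)) : ℂ) / 2) =
      (((Real.pi * t) ^ ((d : ℝ) / 2) : ℝ) : ℂ) := by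
      rw [Complex.ofReal_cpow (by positivity)]
      simp
    rw [this, ← Complex.ofReal_mul, ← Real.rpow_add (by positivity)]
    simp [neg_div]
  rw [h1, one_mul]
  congr 1
  rw [Complex.I_sq]
  push_cast
  have : (t : ℂ) ≠ 0 := by exact_mod_cast ht.ne'
  field_simp

theorem map_eval_midTime {d : ℕ} {t : ℝ} (ht : 0 < t)
    {μ : Measure (PathSpace d (2 * t))} (hμ : IsBrownianBridgeLaw μ) :
    μ.map (fun Φ => Φ (midTime ht)) =
      volume.withDensity fun z => ENNReal.ofReal (midDensity t z) := by
  have := hμ.gaussian.isProbabilityMeasure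
  have hg := hμ.gaussian.hasGaussianLaw_eval (midTime ht)
  have : IsFiniteMeasure (volume.withDensity fun z : EuclideanSpace ℝ (Fin d) =>
      ENNReal.ofReal (midDensity t z)) :=
    isFiniteMeasure_withDensity_ofReal (integrable_midDensity ht).2
  have hG := hg.isGaussian_map
  refine Measure.ext_of_charFun ?_
  ext w
  rw [charFun_midDensity ht, IsGaussian.charFun_eq']
  have hm : (μ.map (fun Φ => Φ (midTime ht)))[id] = 0 := by
    simp only [id]
    rw [integral_map hg.aemeasurable (by fun_prop)]
    exact hμ.mean _
  have hc := covarianceBilin_apply_pi (μ := μ)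
    (X := fun i (Φ : PathSpace d (2 * t)) => Φ (midTime ht) i)
    (fun i => (hμ.gaussian.coordinates.hasGaussianLaw_eval (midTime ht, i)).memLp_two) w w
  simp only [hμ.cov, midTime, mul_ite, mul_zero, Finset.sum_ite_eq, Finset.mem_univ, if_true] at hc
  have hc' : covarianceBilin (μ.map (fun Φ => Φ (midTime ht))) w w = t / 2 * ‖w‖ ^ 2 := by
    refine Eq.trans hc ?_
    rw [EuclideanSpace.norm_sq_eq, Finset.mul_sum]
    refine Finset.sum_congr rfl fun i _ => ?_
    rw [min_self, Real.norm_eq_abs, sq_abs]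
    field_simp
    ring
  rw [hm, hc']
  congr 1
  simp
  ring

/-- The two halves and the midpoint value of a bridge on `[0, 2t]` are independent: two bridges on
`[0, t]` and a Gaussian variable. -/
theorem map_bridgePieces {d : ℕ} {t : ℝ} (ht : 0 < t) :
    (brownianBridge d (2 * t)).map
        (fun Φ => ((bridgePiece ht 0 Φ, bridgePiece ht 1 Φ), Φ (midTime ht))) =
      ((brownianBridge d t).prod (brownianBridge d t)).prod
        (volume.withDensity fun z => ENNReal.ofReal (midDensity t z)) := by
  have hμ := isBrownianBridgeLaw_brownianBridge d (2 * t)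
  have := hμ.gaussian.isProbabilityMeasure
  have : Nonempty (Set.Icc (0 : ℝ) t) := ⟨⟨0, le_rfl, ht.le⟩⟩
  have hi := iIndepFun_bridgePiece ht hμ
  have hm := fun k => (continuous_bridgePiece (d := d) ht k).measurable
  have hlaw : ∀ k : Fin 3, k ≠ 2 →
      (brownianBridge d (2 * t)).map (bridgePiece ht k) = brownianBridge d t := fun k hk =>
    (isBrownianBridgeLaw_map_bridgePiece ht hμ hk).unique (isBrownianBridgeLaw_brownianBridge d t)
  have h01 := (hi.indepFun (show (0 : Fin 3) ≠ 1 by decide)).map_prod_eq_prod_map_map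
    (hm 0).aemeasurable (hm 1).aemeasurable
  rw [hlaw 0 (by decide), hlaw 1 (by decide)] at h01
  -- The midpoint value is recovered from the constant third piece by evaluation at any time.
  have hev : Measurable fun Φ : PathSpace d t => Φ ⟨0, le_rfl, ht.le⟩ :=
    Continuous.measurable (by fun_prop)
  have h2 := (hi.indepFun_prodMk hm 0 1 2 (by decide) (by decide)).comp measurable_id hev
  have e : (fun Φ : PathSpace d t => Φ ⟨0, le_rfl, ht.le⟩) ∘ bridgePiece ht 2 =
      fun Φ => Φ (midTime ht) := by
    ext Φ : 1
    simp [bridgePiece_apply, pieceTime, pieceCoeff]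
  rw [e] at h2
  have h3 := h2.map_prod_eq_prod_map_map ((hm 0).prodMk (hm 1)).aemeasurable
    (hμ.gaussian.aemeasurable _)
  rw [map_eval_midTime ht hμ] at h3
  rw [← h01]
  exact h3

/-! ### Time integrals along paths -/

instance (T : ℝ) : IsFiniteMeasure (timeMeasure T) := by
  refine ⟨?_⟩
  rw [timeMeasure, (MeasurableEmbedding.subtype_coe measurableSet_Icc).comap_apply,
    Set.image_univ, Subtype.range_coe, Real.volume_Icc]
  exact ENNReal.ofReal_lt_top

theorem integral_timeMeasure {T : ℝ} (hT : 0 ≤ T) (g : ℝ → ℝ) :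
    ∫ s : Set.Icc (0 : ℝ) T, g s ∂(timeMeasure T) = ∫ s in (0 : ℝ)..T, g s := by
  rw [timeMeasure, integral_subtype_comap measurableSet_Icc, integral_Icc_eq_integral_Ioc,
    intervalIntegral.integral_of_le hT]

theorem integral_timeMeasure_two_mul {t : ℝ} (ht : 0 < t) {f : Set.Icc (0 : ℝ) (2 * t) → ℝ}
    (hf : Continuous f) :
    ∫ s, f s ∂(timeMeasure (2 * t)) = ∫ s, f (firstHalf t s) ∂(timeMeasure t) +
      ∫ s, f (secondHalf t s) ∂(timeMeasure t) := by
  have h2 : (0 : ℝ) ≤ 2 * t := by linarith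
  set g : ℝ → ℝ := Set.IccExtend h2 f with hg
  have hgc : Continuous g := hf.Icc_extend'
  have hgf : ∀ a : Set.Icc (0 : ℝ) (2 * t), f a = g a := fun a => by simp [hg]
  simp_rw [hgf]
  rw [integral_timeMeasure h2 g]
  have e1 : ∫ s, g (firstHalf t s) ∂(timeMeasure t) = ∫ s in (0 : ℝ)..t, g s :=
    integral_timeMeasure ht.le g
  have e2 : ∫ s, g (secondHalf t s) ∂(timeMeasure t) = ∫ s in (0 : ℝ)..t, g (2 * t - s) :=
    integral_timeMeasure ht.le fun s => g (2 * t - s)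
  rw [e1, e2, intervalIntegral.integral_comp_sub_left, sub_zero,
    show 2 * t - t = t by ring,
    intervalIntegral.integral_add_adjacent_intervals (hgc.intervalIntegrable _ _)
      (hgc.intervalIntegrable _ _)]

/-- The weight `exp (-∫₀ᵗ V)` along the bridge from `x` to `y` obtained from the bridge `Φ` from `0`
to `0` by adding the linear interpolation. -/
noncomputable def feynmanKacWeight {d : ℕ} (V : EuclideanSpace ℝ (Fin d) → ℝ) (t : ℝ)
    (x y : EuclideanSpace ℝ (Fin d)) (Φ : PathSpace d t) : ℝ :=
  Real.exp (-∫ s, V (Φ s + t⁻¹ • ((s : ℝ) • y + (t - s) • x)) ∂(timeMeasure t))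

/-- The expectation of `feynmanKacWeight` under the Brownian bridge. -/
noncomputable def feynmanKacExpectation {d : ℕ} (V : EuclideanSpace ℝ (Fin d) → ℝ) (t : ℝ)
    (x y : EuclideanSpace ℝ (Fin d)) : ENNReal :=
  ∫⁻ Φ, ENNReal.ofReal (feynmanKacWeight V t x y Φ) ∂(brownianBridge d t)

section

variable {d : ℕ} {V : EuclideanSpace ℝ (Fin d) → ℝ}

theorem measurable_feynmanKacWeight (hV : Continuous V) (t : ℝ) :
    Measurable fun p : (EuclideanSpace ℝ (Fin d) × EuclideanSpace ℝ (Fin d)) × PathSpace d t =>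
      feynmanKacWeight V t p.1.1 p.1.2 p.2 := by
  have h : StronglyMeasurable fun q : ((EuclideanSpace ℝ (Fin d) × EuclideanSpace ℝ (Fin d)) ×
      PathSpace d t) × Set.Icc (0 : ℝ) t =>
      V (q.1.2 q.2 + t⁻¹ • ((q.2 : ℝ) • q.1.1.2 + (t - q.2) • q.1.1.1)) :=
    Continuous.stronglyMeasurable (by fun_prop)
  exact (h.integral_prod_right' (ν := timeMeasure t)).measurable.neg.exp

theorem measurable_integral_path (hV : Continuous V) (T : ℝ) :
    Measurable fun Φ : PathSpace d T => ∫ s, V (Φ s) ∂(timeMeasure T) := by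
  have h : StronglyMeasurable fun q : PathSpace d T × Set.Icc (0 : ℝ) T => V (q.1 q.2) :=
    Continuous.stronglyMeasurable (by fun_prop)
  exact (h.integral_prod_right' (ν := timeMeasure T)).measurable

theorem feynmanKacWeight_nonneg (t : ℝ) (x y : EuclideanSpace ℝ (Fin d)) (Φ : PathSpace d t) :
    0 ≤ feynmanKacWeight V t x y Φ := (Real.exp_pos _).le

theorem feynmanKacWeight_le (hV : Continuous V) {m : ℝ} (hm : ∀ x, m ≤ V x) (t : ℝ)
    (x y : EuclideanSpace ℝ (Fin d)) (Φ : PathSpace d t) :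
    feynmanKacWeight V t x y Φ ≤ Real.exp (-((timeMeasure t).real Set.univ * m)) := by
  refine Real.exp_le_exp.2 (neg_le_neg ?_)
  rw [← smul_eq_mul, ← integral_const]
  refine integral_mono (integrable_const _) ?_ fun s => hm _
  have hc : Continuous fun s : Set.Icc (0 : ℝ) t =>
      V (Φ s + t⁻¹ • ((s : ℝ) • y + (t - s) • x)) := by fun_prop
  exact (BoundedContinuousFunction.mkOfCompact ⟨_, hc⟩).integrable (timeMeasure t)

/-- The weight of a shifted path on `[0, 2t]` is the product of the weights of its two halves, both
of which are bridges from `Φ_0` to `Φ_t`, the second one after time reversal. -/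
theorem exp_neg_integral_add_const (hV : Continuous V) {t : ℝ} (ht : 0 < t)
    (Φ : PathSpace d (2 * t)) (c : EuclideanSpace ℝ (Fin d)) :
    Real.exp (-∫ s, V (Φ s + c) ∂(timeMeasure (2 * t))) =
      feynmanKacWeight V t c (c + Φ (midTime ht)) (bridgePiece ht 0 Φ) *
      feynmanKacWeight V t c (c + Φ (midTime ht)) (bridgePiece ht 1 Φ) := by
  rw [integral_timeMeasure_two_mul ht (f := fun s => V (Φ s + c)) (by fun_prop), neg_add,
    Real.exp_add]
  -- The path at distance `s` from either end of its half, as a piece plus the interpolation from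
  -- `c` to `c + Φ_t`; `a` stands for `Φ_s` or `Φ_{2t - s}`.
  have key : ∀ (s : Set.Icc (0 : ℝ) t) (a : EuclideanSpace ℝ (Fin d)),
      a + c = a - ((s : ℝ) / t) • Φ (midTime ht) +
        t⁻¹ • ((s : ℝ) • (c + Φ (midTime ht)) + (t - s) • c) := by
    intro s a
    have : c = (t⁻¹ * t) • c := by rw [inv_mul_cancel₀ ht.ne', one_smul]
    conv_lhs => rw [this]
    module
  congr 1
  all_goals
    unfold feynmanKacWeight
    congr 3
    ext s
    rw [key s]
    rfl

theorem measurable_feynmanKacExpectation (hV : Continuous V) (t : ℝ) :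
    Measurable fun p : EuclideanSpace ℝ (Fin d) × EuclideanSpace ℝ (Fin d) =>
      feynmanKacExpectation V t p.1 p.2 := by
  have := (isBrownianBridgeLaw_brownianBridge d t).gaussian.isProbabilityMeasure
  exact (measurable_feynmanKacWeight hV t).ennreal_ofReal.lintegral_prod_right'

theorem feynmanKacExpectation_le (hV : Continuous V) {m : ℝ} (hm : ∀ x, m ≤ V x) (t : ℝ)
    (x y : EuclideanSpace ℝ (Fin d)) : feynmanKacExpectation V t x y ≤
      ENNReal.ofReal (Real.exp (-((timeMeasure t).real Set.univ * m))) := by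
  have := (isBrownianBridgeLaw_brownianBridge d t).gaussian.isProbabilityMeasure
  refine (lintegral_mono fun Φ =>
    ENNReal.ofReal_le_ofReal (feynmanKacWeight_le hV hm t x y Φ)).trans ?_
  simp

/-- The Bochner integral in the kernel is the real value of a Lebesgue integral, as its integrand is positive. -/
theorem feynmanKacKernel_eq (hV : Continuous V) (t : ℝ) (x y : EuclideanSpace ℝ (Fin d)) :
    feynmanKacKernel V t x y = heatKernel t x y * (feynmanKacExpectation V t x y).toReal := by
  have h : Measurable fun Φ : PathSpace d t => feynmanKacWeight V t x y Φ :=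
    (measurable_feynmanKacWeight hV t).comp (f := fun Φ => ((x, y), Φ)) measurable_prodMk_left
  have := integral_eq_lintegral_of_nonneg_ae (μ := brownianBridge d t)
    (f := feynmanKacWeight V t x y) (Eventually.of_forall (feynmanKacWeight_nonneg (V := V) t x y)) h.aestronglyMeasurable
  rw [feynmanKacExpectation, ← this]
  simp only [feynmanKacKernel, feynmanKacWeight]

/-! ### The law of the endpoints -/

theorem measurable_endpointMap {t : ℝ} (ht : 0 < t) : Measurable (endpointMap (d := d) ht) :=
  Continuous.measurable (by unfold endpointMap; fun_prop)

/-- The bridge starts at `0`: the variance of each coordinate at time `0` vanishes. -/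
theorem apply_zero_ae_eq_zero {t : ℝ} (ht : 0 < t) :
    ∀ᵐ Φ ∂(brownianBridge d (2 * t)), Φ ⟨0, le_rfl, by linarith⟩ = 0 := by
  have hμ := isBrownianBridgeLaw_brownianBridge d (2 * t)
  have := hμ.gaussian.isProbabilityMeasure
  set z : Set.Icc (0 : ℝ) (2 * t) := ⟨0, le_rfl, by linarith⟩ with hz
  have h : ∀ i : Fin d, ∀ᵐ Φ ∂(brownianBridge d (2 * t)), Φ z i = 0 := by
    intro i
    have hL : MemLp (fun Φ : PathSpace d (2 * t) => Φ z i) 2 (brownianBridge d (2 * t)) :=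
      (hμ.gaussian.coordinates.hasGaussianLaw_eval (z, i)).memLp_two
    have hv := hμ.cov z z i i
    rw [if_pos rfl, covariance_self hL.aemeasurable] at hv
    have hv0 : Var[fun Φ : PathSpace d (2 * t) => Φ z i; brownianBridge d (2 * t)] = 0 := by
      rw [hv]; simp [hz]
    have hm := (EuclideanSpace.proj (𝕜 := ℝ) i).integral_comp_comm
      (hμ.gaussian.hasGaussianLaw_eval z).integrable
    rw [hμ.mean, map_zero] at hm
    filter_upwards [ae_eq_integral_of_variance_eq_zero hL hv0] with Φ hΦ
    exact hΦ.trans hm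
  filter_upwards [ae_all_iff.2 h] with Φ hΦ
  ext i
  exact hΦ i

/-- Conditioning on the midpoint value makes the weights of the two halves independent with equal
expectations, whence the square. -/
theorem lintegral_exp_neg_integral_add_const (hV : Continuous V) {t : ℝ} (ht : 0 < t)
    {f : EuclideanSpace ℝ (Fin d) → ENNReal} (hf : Measurable f) (c : EuclideanSpace ℝ (Fin d)) :
    ∫⁻ Φ, ENNReal.ofReal (Real.exp (-∫ s, V (Φ s + c) ∂(timeMeasure (2 * t)))) *
      f (c + Φ (midTime ht)) ∂(brownianBridge d (2 * t)) =
    ∫⁻ z, ENNReal.ofReal (midDensity t z) *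
      (f (c + z) * feynmanKacExpectation V t c (c + z) ^ 2) := by
  have := (isBrownianBridgeLaw_brownianBridge d t).gaussian.isProbabilityMeasure
  have hE := measurable_feynmanKacExpectation hV t
  have hρ := (continuous_midDensity (d := d) t).measurable
  -- The integrand as a function of the two halves and the midpoint value.
  set H : (PathSpace d t × PathSpace d t) × EuclideanSpace ℝ (Fin d) → ENNReal := fun q =>
    f (c + q.2) * (ENNReal.ofReal (feynmanKacWeight V t c (c + q.2) q.1.1) *
      ENNReal.ofReal (feynmanKacWeight V t c (c + q.2) q.1.2)) with hH
  have hW : Measurable fun q : PathSpace d t × EuclideanSpace ℝ (Fin d) =>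
      ENNReal.ofReal (feynmanKacWeight V t c (c + q.2) q.1) :=
    ((measurable_feynmanKacWeight hV t).comp (f := fun q : PathSpace d t ×
      EuclideanSpace ℝ (Fin d) => ((c, c + q.2), q.1)) (by fun_prop)).ennreal_ofReal
  have hH' : Measurable H := by
    have h1 := hW.comp (f := fun q : (PathSpace d t × PathSpace d t) × EuclideanSpace ℝ (Fin d) =>
      (q.1.1, q.2)) (by fun_prop)
    have h2 := hW.comp (f := fun q : (PathSpace d t × PathSpace d t) × EuclideanSpace ℝ (Fin d) =>
      (q.1.2, q.2)) (by fun_prop)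
    have h3 : Measurable fun q : (PathSpace d t × PathSpace d t) × EuclideanSpace ℝ (Fin d) =>
      f (c + q.2) := hf.comp (by fun_prop)
    exact h3.mul (h1.mul h2)
  have hpieces : Measurable fun Φ : PathSpace d (2 * t) =>
      ((bridgePiece ht 0 Φ, bridgePiece ht 1 Φ), Φ (midTime ht)) := by
    have hev : Measurable fun Φ : PathSpace d (2 * t) => Φ (midTime ht) :=
      Continuous.measurable (by fun_prop)
    exact ((continuous_bridgePiece ht 0).measurable.prodMk
      (continuous_bridgePiece ht 1).measurable).prodMk hev
  calc _ = ∫⁻ Φ, H ((bridgePiece ht 0 Φ, bridgePiece ht 1 Φ), Φ (midTime ht))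
        ∂(brownianBridge d (2 * t)) := by
        refine lintegral_congr fun Φ => ?_
        simp only [hH]
        rw [← ENNReal.ofReal_mul (feynmanKacWeight_nonneg _ _ _ _),
          ← exp_neg_integral_add_const hV ht Φ c]
        exact mul_comm _ _
    _ = ∫⁻ z, f (c + z) * feynmanKacExpectation V t c (c + z) ^ 2
        ∂(volume.withDensity fun z => ENNReal.ofReal (midDensity t z)) := by
        rw [← lintegral_map hH' hpieces, map_bridgePieces ht, lintegral_prod_symm _ hH'.aemeasurable]
        refine lintegral_congr fun z => ?_
        have hz : Measurable fun Φ : PathSpace d t =>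
            ENNReal.ofReal (feynmanKacWeight V t c (c + z) Φ) :=
          hW.comp (f := fun Φ => (Φ, z)) measurable_prodMk_right
        have hzz : Measurable fun q : PathSpace d t × PathSpace d t =>
            ENNReal.ofReal (feynmanKacWeight V t c (c + z) q.1) *
              ENNReal.ofReal (feynmanKacWeight V t c (c + z) q.2) :=
          (hz.comp measurable_fst).mul (hz.comp measurable_snd)
        simp only [hH]
        rw [lintegral_const_mul _ hzz, lintegral_prod_mul hz.aemeasurable hz.aemeasurable, sq]
        rfl
    _ = _ := by
        have hE' : Measurable fun z => f (c + z) * feynmanKacExpectation V t c (c + z) ^ 2 :=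
          (hf.comp (measurable_const_add c)).mul
            ((hE.comp (f := fun z => (c, c + z)) (by fun_prop)).pow_const 2)
        rw [lintegral_withDensity_eq_lintegral_mul _ hρ.ennreal_ofReal hE']
        rfl

/-- The law of `(Φ_0, Φ_t)` under the weighted bridge measure, tested against functions: the start `c`
is distributed by Lebesgue measure, and the displacement `z = Φ_t - c` by the Gaussian density, so
that the substitution `y = c + z` produces `midDensity t (y - c)`. -/
theorem lintegral_map_endpointMap (hV : Continuous V) {t : ℝ} (ht : 0 < t)
    {F : EuclideanSpace ℝ (Fin d) × EuclideanSpace ℝ (Fin d) → ENNReal} (hF : Measurable F) :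
    ∫⁻ p, F p ∂((weightedBridge V t).map (endpointMap ht)) =
      ∫⁻ p, ENNReal.ofReal (midDensity t (p.2 - p.1)) * (F p *
        feynmanKacExpectation V t p.1 p.2 ^ 2) := by
  have := (isBrownianBridgeLaw_brownianBridge d (2 * t)).gaussian.isProbabilityMeasure
  have hw : Measurable fun Φ : PathSpace d (2 * t) =>
      ENNReal.ofReal (Real.exp (-∫ s, V (Φ s) ∂(timeMeasure (2 * t)))) :=
    (measurable_integral_path hV (2 * t)).neg.exp.ennreal_ofReal
  have hshift : Measurable fun p : EuclideanSpace ℝ (Fin d) × PathSpace d (2 * t) =>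
      p.2 + ContinuousMap.const _ p.1 :=
    (continuous_snd.add (ContinuousMap.continuous_const'.comp continuous_fst)).measurable
  have hE := measurable_feynmanKacExpectation hV t
  have hρ := (continuous_midDensity (d := d) t).measurable
  have hFe : Measurable fun Φ => F (endpointMap (d := d) ht Φ) :=
    hF.comp (measurable_endpointMap ht)
  rw [lintegral_map hF (measurable_endpointMap ht), weightedBridge,
    lintegral_withDensity_eq_lintegral_mul _ hw hFe, shiftedBridge,
    lintegral_map (hw.mul hFe) hshift]
  refine (lintegral_prod _ ((hw.mul hFe).comp hshift).aemeasurable).trans ?_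
  rw [Measure.volume_eq_prod, lintegral_prod _ (by fun_prop)]
  refine lintegral_congr fun c => ?_
  rw [← lintegral_add_left_eq_self (μ := volume) (fun y => ENNReal.ofReal (midDensity t (y - c)) *
    (F (c, y) * feynmanKacExpectation V t c y ^ 2)) c]
  simp only [add_sub_cancel_left]
  rw [← lintegral_exp_neg_integral_add_const hV ht (f := fun y => F (c, y))
    (hF.comp measurable_prodMk_left) c]
  refine lintegral_congr_ae ?_
  filter_upwards [apply_zero_ae_eq_zero ht] with Φ hΦ
  have e : endpointMap ht (Φ + ContinuousMap.const _ c) = (c, c + Φ (midTime ht)) := by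
    refine Prod.ext ?_ (add_comm _ _)
    simp [endpointMap, hΦ]
  exact congrArg₂ (· * ·) rfl (congrArg F e)

/-- The normalising constant `(4πt)^{-d/2}` turns the midpoint density, a Gaussian of variance `t / 2`,
into the square of the heat kernel of variance `t`. -/
theorem midDensity_mul {t : ℝ} (ht : 0 < t) (x y : EuclideanSpace ℝ (Fin d)) :
    (4 * Real.pi * t) ^ (-(d : ℝ) / 2) * midDensity t (y - x) = heatKernel t x y ^ 2 := by
  unfold midDensity heatKernel
  rw [← mul_assoc, ← Real.mul_rpow (by positivity) (by positivity), mul_pow, ← Real.exp_nat_mul,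
    ← Real.rpow_natCast (_ ^ (_ : ℝ)), ← Real.rpow_mul (by positivity), norm_sub_rev]
  congr 1
  · rw [show 4 * Real.pi * t * (Real.pi * t) = (2 * Real.pi * t) ^ (2 : ℝ) by
      rw [Real.rpow_two]; ring, ← Real.rpow_mul (by positivity)]
    congr 1
    push_cast
    ring
  · congr 1
    field_simp
    push_cast
    ring

theorem heatKernel_nonneg {t : ℝ} (ht : 0 < t) (x y : EuclideanSpace ℝ (Fin d)) :
    0 ≤ heatKernel t x y := by
  unfold heatKernel
  positivity

theorem measurable_feynmanKacKernel (hV : Continuous V) (t : ℝ) :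
    Measurable fun p : EuclideanSpace ℝ (Fin d) × EuclideanSpace ℝ (Fin d) =>
      feynmanKacKernel V t p.1 p.2 := by
  simp_rw [feynmanKacKernel_eq hV]
  have h : Measurable fun p : EuclideanSpace ℝ (Fin d) × EuclideanSpace ℝ (Fin d) =>
      heatKernel t p.1 p.2 := Continuous.measurable (by unfold heatKernel; fun_prop)
  exact h.mul (measurable_feynmanKacExpectation hV t).ennreal_toReal

theorem feynmanKacKernel_nonneg (hV : Continuous V) {t : ℝ} (ht : 0 < t)
    (x y : EuclideanSpace ℝ (Fin d)) : 0 ≤ feynmanKacKernel V t x y := by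
  rw [feynmanKacKernel_eq hV]
  exact mul_nonneg (heatKernel_nonneg ht x y) ENNReal.toReal_nonneg

theorem feynmanKacKernel_le (hV : Continuous V) {m : ℝ} (hm : ∀ x, m ≤ V x) {t : ℝ} (ht : 0 < t)
    (x y : EuclideanSpace ℝ (Fin d)) : feynmanKacKernel V t x y ≤
      (2 * Real.pi * t) ^ (-(d : ℝ) / 2) * Real.exp (-((timeMeasure t).real Set.univ * m)) := by
  rw [feynmanKacKernel_eq hV]
  refine mul_le_mul ?_ (ENNReal.toReal_le_of_le_ofReal (Real.exp_pos _).le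
    (feynmanKacExpectation_le hV hm t x y)) ENNReal.toReal_nonneg (by positivity)
  unfold heatKernel
  refine mul_le_of_le_one_right (by positivity) (Real.exp_le_one_iff.2 ?_)
  rw [neg_div]
  exact neg_nonpos.2 (by positivity)

/-- The normalised law of `(Φ_0, Φ_t)` under the weighted bridge measure has density
`(P_t^V)²`. -/
theorem smul_map_endpointMap_eq_withDensity (hV : Continuous V) {m : ℝ} (hm : ∀ x, m ≤ V x) {t : ℝ}
    (ht : 0 < t) :
    ENNReal.ofReal ((4 * Real.pi * t) ^ (-(d : ℝ) / 2)) •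
      (weightedBridge V t).map (endpointMap ht) =
    volume.withDensity fun p => ENNReal.ofReal (feynmanKacKernel V t p.1 p.2 ^ 2) := by
  have hE := measurable_feynmanKacExpectation hV t
  have hρ := (continuous_midDensity (d := d) t).measurable
  ext A hA
  have h := lintegral_map_endpointMap hV ht (F := A.indicator 1) (measurable_one.indicator hA)
  rw [lintegral_indicator_one hA] at h
  rw [Measure.smul_apply, smul_eq_mul, h, withDensity_apply _ hA, ← lintegral_indicator hA,
    ← lintegral_const_mul _ (by
      have := (measurable_one (α := ENNReal)).indicator hA
      fun_prop)]
  refine lintegral_congr fun p => ?_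
  by_cases hp : p ∈ A
  · rw [Set.indicator_of_mem hp, Set.indicator_of_mem hp, Pi.one_apply, one_mul, ← mul_assoc,
      ← ENNReal.ofReal_mul (by positivity), midDensity_mul ht, feynmanKacKernel_eq hV, mul_pow,
      ENNReal.ofReal_mul (sq_nonneg _), ENNReal.ofReal_pow ENNReal.toReal_nonneg,
      ENNReal.ofReal_toReal (ne_top_of_le_ne_top ENNReal.ofReal_ne_top
        (feynmanKacExpectation_le hV hm t _ _))]
  · simp [hp]

end

theorem mainTheorem3 (d : ℕ) (V : EuclideanSpace ℝ (Fin d) → ℝ) (hV : ContDiff ℝ (⊤ : ℕ∞) V)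
    (hVb : BddBelow (Set.range V)) (t : ℝ) (ht : 0 < t) :
    HalfDensityEq
        (fun p : EuclideanSpace ℝ (Fin d) × EuclideanSpace ℝ (Fin d) =>
          feynmanKacKernel V t p.1 p.2) volume
        (fun _ => 1)
        (ENNReal.ofReal ((4 * Real.pi * t) ^ (-(d : ℝ) / 2)) •
          (weightedBridge V t).map (endpointMap ht)) ∧
      (MemLp (fun p : EuclideanSpace ℝ (Fin d) × EuclideanSpace ℝ (Fin d) =>
          feynmanKacKernel V t p.1 p.2) 2 volume ↔ IsFiniteMeasure (weightedBridge V t)) := by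
  have hVc := hV.continuous
  obtain ⟨m, hm⟩ := hVb
  replace hm : ∀ x, m ≤ V x := fun x => hm ⟨x, rfl⟩
  have hmeas := measurable_feynmanKacKernel hVc t
  have hdens := smul_map_endpointMap_eq_withDensity hVc hm ht
  refine ⟨?_, ?_⟩
  · rw [hdens]
    set C : ℝ := (2 * Real.pi * t) ^ (-(d : ℝ) / 2) *
      Real.exp (-((timeMeasure t).real Set.univ * m))
    have hle : ∀ p : EuclideanSpace ℝ (Fin d) × EuclideanSpace ℝ (Fin d),
        ENNReal.ofReal (feynmanKacKernel V t p.1 p.2 ^ 2) ≤ ENNReal.ofReal (C ^ 2) := fun p =>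
      ENNReal.ofReal_le_ofReal (pow_le_pow_left₀ (feynmanKacKernel_nonneg hVc ht _ _)
        (feynmanKacKernel_le hVc hm ht _ _) 2)
    refine ⟨inferInstance, ⟨fun p => ?_⟩, volume, inferInstance, Measure.AbsolutelyContinuous.rfl,
      withDensity_absolutelyContinuous _ _, ?_⟩
    -- Local finiteness: the density is bounded by `C ^ 2`.
    · obtain ⟨s, hs, hs'⟩ := (volume : Measure
        (EuclideanSpace ℝ (Fin d) × EuclideanSpace ℝ (Fin d))).finiteAt_nhds p
      refine ⟨s, hs, ?_⟩
      rw [withDensity_apply' _ s]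
      refine (lintegral_mono hle).trans_lt ?_
      rw [lintegral_const, Measure.restrict_apply_univ]
      exact ENNReal.mul_lt_top ENNReal.ofReal_lt_top hs'
    · filter_upwards [Measure.rnDeriv_self (volume : Measure
          (EuclideanSpace ℝ (Fin d) × EuclideanSpace ℝ (Fin d))),
        Measure.rnDeriv_withDensity volume (hmeas.pow_const 2).ennreal_ofReal] with p h1 h2
      rw [h1, h2, ENNReal.toReal_ofReal (sq_nonneg _),
        Real.sqrt_sq (feynmanKacKernel_nonneg hVc ht _ _)]
      simp
  · have hmass : ENNReal.ofReal ((4 * Real.pi * t) ^ (-(d : ℝ) / 2)) *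
        weightedBridge V t Set.univ =
        ∫⁻ p : EuclideanSpace ℝ (Fin d) × EuclideanSpace ℝ (Fin d),
          ENNReal.ofReal (feynmanKacKernel V t p.1 p.2 ^ 2) := by
      have h := congrArg (fun ν => ν Set.univ) hdens
      simpa [Measure.map_apply (measurable_endpointMap ht) MeasurableSet.univ] using h
    have hc0 : ENNReal.ofReal ((4 * Real.pi * t) ^ (-(d : ℝ) / 2)) ≠ 0 :=
      (ENNReal.ofReal_pos.2 (by positivity)).ne'
    rw [memLp_two_iff_integrable_sq hmeas.aestronglyMeasurable,
      Integrable, and_iff_right (hmeas.pow_const 2).aestronglyMeasurable,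
      hasFiniteIntegral_iff_ofReal (Eventually.of_forall fun _ => sq_nonneg _), ← hmass,
      isFiniteMeasure_iff]
    refine ⟨fun h => ?_, fun h => ENNReal.mul_lt_top ENNReal.ofReal_lt_top h⟩
    exact ENNReal.lt_top_of_mul_ne_top_right h.ne hc0
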